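/- **Theorem.** Let $F=\mathbb F_q$ be a finite field with $q$ odd, and let $G=\mathrm{PGL}_2(q)=\mathrm{GL}_2(F)/F^\times$. Let $X$ be the set of nondegenerate bilinear forms on $F^2$ that are symmetric or alternating, taken modulo nonzero scalars ("mod centre"), with the action of $G$ induced by $(g\cdot B)(u,v)=B(g^{-1}u,g^{-1}v)$. For $x\in X$ let $\mathrm{Isotr}(x)$ be the set of lines $L\subset F^2$ with $B(v,v)=0$ for all $v\in L$ and $B\in x$; the isotropy group $G_x$ permutes $\mathrm{Isotr}(x)$, and $\varepsilon\colon G_x\to\{\pm1\}$ denotes the sign of this permutation. The action groupoid $A(X,G)$ has the points of $X$ as objects and the triples $(x,g,y)$ with $g\cdot x=y$ as arrows. An extension of $\varepsilon$ is a representation $\tilde\varepsilon$ of $A(X,G)$ on one-dimensional complex vector spaces $W_x$ $(x\in X)$ such that $\tilde\varepsilon(x,h,x)$ is multiplication by $\varepsilon(h)$ for all $x\in X$, $h\in G_x$. Its induced representation $\mathrm{Ind}_{A(X,G)}^G(\tilde\varepsilon)$ is the space of sections $f\in\prod_{x\in X}W_x$ with $$(\rho_g f)(x)=\tilde\varepsilon(g^{-1}x,g,x)\,[f(g^{-1}x)].$$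 Let $x_1\in X$ be the class of the split form $(a,b)\mapsto ab$ (in any coordinates), $x_2\in X$ the class of the norm form of the quadratic extension $E/F$ (for any $F$-linear identification $E\cong F^2$), and $x_3\in X$ the class of the alternating forms. Put $H_i=G_{x_i}$ and $\varepsilon_i=\varepsilon|_{H_i}$. Let $T_1\subset H_1$ and $T_2\subset H_2$ be the split and non-split tori, i.e. the images in $G$ of $(F\times F)^\times$ and $E^\times$ acting on $F\times F\cong F^2$ and on $E\cong F^2$ by multiplication. Let $\mathrm{sgn}\colon G\to\{\pm1\}$ send the class of $g$ to $1$ if $\det g$ is a square and to $-1$ otherwise. Then: 1. $\varepsilon_1$ has order $2$ and is trivial on $T_1$, $\varepsilon_2$ is trivial, and $\varepsilon_3=\mathrm{sgn}|_{H_3}$. 2. $\varepsilon$ has an extension $\tilde\varepsilon$ to $A(X,G)$, and for every extension $\tilde\varepsilon$ $$\mathrm{Ind}_{A(X,G)}^G(\tilde\varepsilon)\;\cong\;\mathrm{Ind}_{H_1}^G\varepsilon_1\oplus\mathrm{Ind}_{H_2}^G\varepsilon_2\oplus\mathrm{Ind}_{H_3}^G\varepsilon_3 .$$ 3. For every extension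 $\tilde\varepsilon$, the representation $\mathrm{Ind}_{A(X,G)}^G(\tilde\varepsilon)$ is a Gelfand model for $G$: it is a finite-dimensional complex representation that contains every irreducible complex representation of $G$ with multiplicity one. 4. For every extension $\tilde\varepsilon$ and every character $\psi_2$ of $H_2$ of order $2$ that is trivial on $T_2$, the representation $\mathrm{Ind}_{A(X,G)}^G(\tilde\varepsilon)$ is isomorphic to the Bump–Ginzburg model $M=\mathrm{Ind}_{H_1}^G\mathbf 1\oplus\mathrm{Ind}_{H_2}^G\psi_2\oplus\mathrm{Ind}_{H_3}^G\mathrm{sgn}|_{H_3}$. -/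

import Mathlib

open CategoryTheory
open scoped MatrixGroups LinearAlgebra.Projectivization

universe u v w

/-! ### Representations of an action groupoid and their induction to the group -/

section ActionGroupoid

variable {G : Type u} [Group G] {X : Type v} [MulAction G X]

variable (G) in
/-- A point of `X` as an object of the action groupoid `A(G, X)`. -/
def groupoidPt (x : X) : ActionCategory G X := x

/-- The arrow `(x, g, y)`, where `y = g • x`, of the action groupoid `A(G, X)`. -/
def groupoidArrow (g : G) {x y : X} (h : g • x = y) :
    groupoidPt G x ⟶ groupoidPt G y :=
  ⟨g, h⟩

/-- The action `(ρ_g f)(x) = σ(g⁻¹ • x, g, x) (f (g⁻¹ • x))` on sections `f` of the bundle of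
fibres of a representation `σ` of the action groupoid. -/
noncomputable def groupoidIndAux (σ : ActionCategory G X ⥤ FGModuleCat.{w} ℂ) (g : G) :
    (∀ x : X, σ.obj (groupoidPt G x)) →ₗ[ℂ]
      (∀ x : X, σ.obj (groupoidPt G x)) :=
  LinearMap.pi fun x =>
    (σ.map (groupoidArrow g (smul_inv_smul g x))).hom.hom ∘ₗ LinearMap.proj (g⁻¹ • x)

lemma groupoidIndAux_apply (σ : ActionCategory G X ⥤ FGModuleCat.{w} ℂ) (g : G)
    (f : ∀ x : X, σ.obj (groupoidPt G x)) {x y : X} (h : g • y = x) :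
    groupoidIndAux σ g f x = (σ.map (groupoidArrow g h)).hom.hom (f y) := by
  have hy : y = g⁻¹ • x := by rw [← h, inv_smul_smul]
  subst hy
  rfl

/-- `Ind_{A(X,G)}^G (σ)`: the natural representation of `G` on the space of all sections,
twisted by the representation `σ` of the action groupoid. -/
noncomputable def groupoidInd (σ : ActionCategory G X ⥤ FGModuleCat.{w} ℂ) :
    Representation ℂ G (∀ x : X, σ.obj (groupoidPt G x)) where
  toFun := groupoidIndAux σ
  map_one' := by
    refine LinearMap.ext fun f => funext fun x => ?_
    rw [groupoidIndAux_apply σ 1 f (one_smul G x)]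
    have : groupoidArrow (1 : G) (one_smul G x) = 𝟙 (groupoidPt G x) := rfl
    rw [this, σ.map_id]
    rfl
  map_mul' g h := by
    refine LinearMap.ext fun f => funext fun x => ?_
    have h1 : h • h⁻¹ • g⁻¹ • x = g⁻¹ • x := smul_inv_smul _ _
    have h2 : g • g⁻¹ • x = x := smul_inv_smul _ _
    have h3 : (g * h) • h⁻¹ • g⁻¹ • x = x := by rw [mul_smul, h1, h2]
    rw [groupoidIndAux_apply σ (g * h) f h3, Module.End.mul_apply,
      groupoidIndAux_apply σ g _ h2, groupoidIndAux_apply σ h f h1]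
    have : groupoidArrow (g * h) h3 = groupoidArrow h h1 ≫ groupoidArrow g h2 := rfl
    rw [this, σ.map_comp]
    rfl

end ActionGroupoid

/-! ### Linear characters, induction from a subgroup, Gelfand models -/

/-- The one-dimensional representation of `H` on `ℂ` given by a linear character. -/
noncomputable def linearCharRep {H : Type u} [Group H] (χ : H →* ℂˣ) : Representation ℂ H ℂ where
  toFun h := (χ h : ℂ) • LinearMap.id
  map_one' := by ext; simp
  map_mul' a b := by ext; simp [mul_comm]

/-- `Ind_H^G χ` for a linear character `χ` of a subgroup `H` of `G`. -/
noncomputable abbrev indChar {G : Type u} [Group G] (H : Subgroup G) (χ : H →* ℂˣ) :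
    Representation ℂ G (Representation.IndV H.subtype (linearCharRep χ)) :=
  Representation.ind H.subtype (linearCharRep χ)

/-- A Gelfand model of a finite group: a finite-dimensional complex representation which contains
every irreducible representation `τ` with multiplicity `dim Hom_G(τ, ρ)` equal to one. -/
def IsGelfandModel {G : Type u} [Group G] {M : Type v} [AddCommGroup M] [Module ℂ M]
    (ρ : Representation ℂ G M) : Prop :=
  Module.Finite ℂ M ∧
    ∀ (V : Type) [AddCommGroup V] [Module ℂ V] [Module.Finite ℂ V] (τ : Representation ℂ G V),
      τ.IsIrreducible → Module.finrank ℂ (Representation.IntertwiningMap τ ρ) = 1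

/-! ### Forms on the plane modulo the centre -/

section Forms

variable (F : Type u) [Field F]

/-- Nondegenerate bilinear forms on the plane `F²` which are symmetric or alternating. -/
abbrev PlaneForm : Type u :=
  {B : LinearMap.BilinForm F (Fin 2 → F) // B.Nondegenerate ∧ (B.IsSymm ∨ B.IsAlt)}

/-- Two forms are identified when they differ by a nonzero scalar. -/
def planeFormSetoid : Setoid (PlaneForm F) where
  r B C := ∃ c : Fˣ, C.1 = (c : F) • B.1
  iseqv :=
    { refl := fun B => ⟨1, by simp⟩
      symm := by
        rintro B C ⟨c, h⟩
        exact ⟨c⁻¹, by rw [h, smul_smul]; simp⟩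
      trans := by
        rintro B C D ⟨c, h⟩ ⟨d, h'⟩
        exact ⟨d * c, by rw [h', h, smul_smul, Units.val_mul]⟩ }

/-- The set `X` of nondegenerate symmetric or alternating forms on `F²` mod centre. -/
def FormClass : Type u := Quotient (planeFormSetoid F)

variable {F}

/-- The class mod centre of a form. -/
def FormClass.mk (B : PlaneForm F) : FormClass F := Quotient.mk (planeFormSetoid F) B

/-- The form `(u, v) ↦ B (g⁻¹ u, g⁻¹ v)`. -/
def PlaneForm.transport (g : GL (Fin 2) F) (B : PlaneForm F) : PlaneForm F :=
  ⟨LinearMap.BilinForm.congr (DistribMulAction.toLinearEquiv F (Fin 2 → F) g) B.1,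
    LinearMap.BilinForm.Nondegenerate.congr _ B.2.1,
    B.2.2.imp (fun h => ⟨fun x y => by simpa using h.eq _ _⟩)
      (fun h x => by simpa using h _)⟩

@[simp]
lemma PlaneForm.transport_apply (g : GL (Fin 2) F) (B : PlaneForm F) (u v : Fin 2 → F) :
    (B.transport g).1 u v = B.1 (g⁻¹ • u) (g⁻¹ • v) := rfl

/-- `GL₂(F)` acts on form classes by `(g • B)(u, v) = B (g⁻¹ u, g⁻¹ v)`. -/
instance : MulAction (GL (Fin 2) F) (FormClass F) where
  smul g := Quotient.map (PlaneForm.transport g) (by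
    rintro B C ⟨c, h⟩
    refine ⟨c, ?_⟩
    ext
    simp [h])
  one_smul x := by
    induction x using Quotient.inductionOn with
    | _ B =>
      refine congrArg (Quotient.mk _) (Subtype.ext ?_)
      refine LinearMap.ext fun u => LinearMap.ext fun v => ?_
      simp
  mul_smul g h x := by
    induction x using Quotient.inductionOn with
    | _ B =>
      refine congrArg (Quotient.mk _) (Subtype.ext ?_)
      refine LinearMap.ext fun u => LinearMap.ext fun v => ?_
      simp [mul_smul]

lemma FormClass.smul_mk (g : GL (Fin 2) F) (B : PlaneForm F) :
    g • FormClass.mk B = FormClass.mk (B.transport g) := rfl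

/-- The induced action of `PGL₂(F)` on form classes. -/
instance : MulAction PGL(2, F) (FormClass F) :=
  Matrix.ProjGenLinGroup.mulActionOfGL fun c x => by
    induction x using Quotient.inductionOn with
    | _ B =>
      refine Quotient.sound (s := planeFormSetoid F) ⟨c ^ 2, ?_⟩
      refine LinearMap.ext fun u => LinearMap.ext fun v => ?_
      have key : ∀ w : Fin 2 → F, (Matrix.GeneralLinearGroup.scalar (Fin 2) c)⁻¹ • w =
          (↑c⁻¹ : F) • w := by
        intro w
        rw [inv_smul_eq_iff]
        ext i
        simp [Units.smul_def]
      change B.1 u v = ((c ^ 2 : Fˣ) : F) •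
        B.1 ((Matrix.GeneralLinearGroup.scalar (Fin 2) c)⁻¹ • u)
          ((Matrix.GeneralLinearGroup.scalar (Fin 2) c)⁻¹ • v)
      rw [key, key]
      simp
      field_simp

lemma FormClass.pgl_smul_mk (g : GL (Fin 2) F) (B : PlaneForm F) :
    (Matrix.ProjGenLinGroup.mk g : PGL(2, F)) • FormClass.mk B =
      FormClass.mk (B.transport g) := rfl

/-- A line `L` is isotropic for the class `x` if the forms in `x` vanish on it. -/
def IsIsotropicLine (x : FormClass F) (L : ℙ F (Fin 2 → F)) : Prop :=
  ∀ B : PlaneForm F, FormClass.mk B = x → ∀ v ∈ L.submodule, B.1 v v = 0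

/-- `Isotr(x)`: the set of isotropic lines of `x`, with the natural action of `G_x`. -/
def isotropicLines (x : FormClass F) :
    SubMulAction (MulAction.stabilizer PGL(2, F) x) (ℙ F (Fin 2 → F)) where
  carrier := {L | IsIsotropicLine x L}
  smul_mem' := by
    rintro ⟨g, hg⟩ L hL B hB v hv
    obtain ⟨g, rfl⟩ := Matrix.ProjGenLinGroup.mk_surjective g
    have hB' : FormClass.mk (B.transport g⁻¹) = x := by
      rw [← FormClass.pgl_smul_mk, hB, map_inv, inv_smul_eq_iff]
      exact hg.symm
    induction L using Projectivization.ind with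
    | h w hw =>
      have hv' : v ∈ (Projectivization.mk F (g • w) ((smul_ne_zero_iff_ne g).2 hw)).submodule := hv
      rw [Projectivization.submodule_mk, Submodule.mem_span_singleton] at hv'
      obtain ⟨a, rfl⟩ := hv'
      have h0 := hL _ hB' w (by simp)
      rw [PlaneForm.transport_apply, inv_inv] at h0
      simp only [map_smul, LinearMap.smul_apply, h0, smul_zero]

/-- The character `ε` of the isotropy group `G_x`: the sign of the permutation of the isotropic
lines of `x` (with values in `{1, -1} ⊆ ℂˣ`). -/
noncomputable def isotropySign [Finite F] (x : FormClass F) :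
    MulAction.stabilizer PGL(2, F) x →* ℂˣ := by
  classical
  letI : Fintype (isotropicLines x) := Fintype.ofFinite _
  exact (Units.map (Int.castRingHom ℂ).toMonoidHom).comp
    (Equiv.Perm.sign.comp
      (MulAction.toPermHom (MulAction.stabilizer PGL(2, F) x) (isotropicLines x)))

/-- `σ` is a one-dimensional representation of the action groupoid `A(X, PGL₂(F))` whose
restriction to each isotropy group `G_x` is the sign character `ε`. -/
def IsSignExtension [Finite F]
    (σ : ActionCategory PGL(2, F) (FormClass F) ⥤ FGModuleCat.{w} ℂ) : Prop :=
  (∀ x : FormClass F, Module.finrank ℂ (σ.obj (groupoidPt PGL(2, F) x)) = 1) ∧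
    ∀ (x : FormClass F) (h : MulAction.stabilizer PGL(2, F) x),
      (σ.map (groupoidArrow (h : PGL(2, F)) h.2)).hom.hom =
        (isotropySign x h : ℂ) • LinearMap.id

/-! ### The three orbits, the tori and the sign character of `PGL₂(F)` -/

/-- `x` is the class of the split form `(a, b) ↦ a b`, in the coordinates given by `e`. -/
def IsSplitClass (e : (Fin 2 → F) ≃ₗ[F] F × F) (x : FormClass F) : Prop :=
  ∃ B : PlaneForm F, FormClass.mk B = x ∧ ∀ v, B.1 v v = (e v).1 * (e v).2

/-- `x` is the class of the norm form of `E` over `F`, where `E` is identified with `F²` by `e`. -/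
def IsNormClass {E : Type v} [Field E] [Algebra F E] (e : (Fin 2 → F) ≃ₗ[F] E)
    (x : FormClass F) : Prop :=
  ∃ B : PlaneForm F, FormClass.mk B = x ∧ ∀ v, B.1 v v = Algebra.norm F (e v)

/-- `x` is the class of the alternating forms. -/
def IsAlternatingClass (x : FormClass F) : Prop :=
  ∃ B : PlaneForm F, FormClass.mk B = x ∧ B.1.IsAlt

/-- `t` belongs to the torus of `PGL₂(F)` of all multiplications by units of the `F`-algebra `A`,
where `A` is identified with `F²` by `e`. The torus is split for `A = F × F` and non-split for
`A` a quadratic field extension. -/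
def MemTorus {A : Type v} [CommRing A] [Algebra F A] (e : (Fin 2 → F) ≃ₗ[F] A)
    (t : PGL(2, F)) : Prop :=
  ∃ (g : GL (Fin 2) F) (a : Aˣ),
    Matrix.ProjGenLinGroup.mk g = t ∧ ∀ v : Fin 2 → F, e (g • v) = a * e v

/-- The sign character of `PGL₂(F)`, `F` finite: it sends the class of `g` to `1` or `-1` as
`det g` is a square or not. -/
noncomputable def detSign [Fintype F] [DecidableEq F] : PGL(2, F) →* ℂˣ :=
  QuotientGroup.lift (Subgroup.center (GL (Fin 2) F))
    ((Units.map (Int.castRingHom ℂ).toMonoidHom).comp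
      ((quadraticChar F).toUnitHom.comp Matrix.GeneralLinearGroup.det))
    (by
      intro g hg
      rw [Matrix.GeneralLinearGroup.center_eq_range_scalar] at hg
      obtain ⟨c, rfl⟩ := hg
      have : Matrix.GeneralLinearGroup.det (Matrix.GeneralLinearGroup.scalar (Fin 2) c) = c ^ 2 := by
        ext; simp
      rw [MonoidHom.mem_ker, MonoidHom.comp_apply, MonoidHom.comp_apply, this]
      have h : (quadraticChar F).toUnitHom (c ^ 2) = 1 := by
        ext
        simp
      rw [h, map_one])

lemma detSign_mk [Fintype F] [DecidableEq F] (g : GL (Fin 2) F) :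
    (detSign (Matrix.ProjGenLinGroup.mk g) : ℂ) =
      (quadraticChar F (Matrix.GeneralLinearGroup.det g : F) : ℤ) := rfl

end Forms

/-! ### Characters determine complex representations -/

section Characters

open Representation Module

variable {G : Type*} [Group G]

/-! Everything is read off from characters. Writing a form as `B(u, v) = ω(u, A v)`, with `ω` the
area form, turns classes of forms into matrices `A` up to scalars, where `A` is traceless (symmetric
forms) or scalar (alternating forms). The action becomes conjugation, so `X` is the set of solutions
of `h² = 1` in `G`. Isotropic lines are eigenlines of `A`, and `A² = -det A` when `A` is traceless;
hence there are two isotropic lines if `-det A` is a square and none otherwise. An element `g` fixes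
a symmetric class exactly when it commutes or anticommutes with `A`; in the first case it fixes each
isotropic line, in the second it exchanges them. On the alternating class every line is isotropic,
and the sign of `g` on the projective line is the quadratic character `χ(det g)`.

The character of the groupoid representation at `g` is the sum of the values of `ε` over the fixed
points. Anticommuting classes contribute `δ χ(-det A)` with `δ = -1`. Multiplication by an element
of `F[g]` of nonsquare determinant exchanges split and non-split anticommuting classes, so their
contributions cancel for every `δ`. For nonscalar `g` there remains `χ(det g)` plus the number of
commuting symmetric classes, which is `0` or `1` according to whether the discriminant of `g`
vanishes. This is the number of square roots of `g` in `G` (`FormClass.sum_weight_eq_card_sqrt`).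
The choice `δ = 1` gives the Bump–Ginzburg model, so both models have the same character.

By Frobenius and Schur, the multiplicity of an irreducible `τ` in a representation whose character
counts square roots is the average of `χ_τ(g²)`. Every element of `G` is conjugate to its inverse,
so this average is `1` or `-1`; being a dimension, it is `1`. -/

lemma Representation.character_prod {V W : Type*} [AddCommGroup V] [Module ℂ V]
    [Module.Finite ℂ V] [AddCommGroup W] [Module ℂ W] [Module.Finite ℂ W]
    (ρ : Representation ℂ G V) (σ : Representation ℂ G W) (g : G) :
    (ρ.prod σ).character g = ρ.character g + σ.character g :=
  LinearMap.trace_prodMap' (ρ g) (σ g)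

/-- Complementary subrepresentations decompose a representation as a direct sum. -/
noncomputable def Subrepresentation.prodEquivOfIsCompl {V : Type*} [AddCommGroup V] [Module ℂ V]
    {ρ : Representation ℂ G V} (p q : Subrepresentation ρ) (h : IsCompl p q) :
    (p.toRepresentation.prod q.toRepresentation).Equiv ρ :=
  Representation.Equiv.mk
    (Submodule.prodEquivOfIsCompl p.toSubmodule q.toSubmodule
      ⟨disjoint_iff.2 (congrArg Subrepresentation.toSubmodule h.1.eq_bot),
        codisjoint_iff.2 (congrArg Subrepresentation.toSubmodule h.2.eq_top)⟩) (by
    intro g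
    ext x <;> simp [Subrepresentation.toRepresentation])

/-- The direct sum of two equivalences of representations. -/
noncomputable def Representation.Equiv.prodCongr {V V' W W' : Type*}
    [AddCommGroup V] [Module ℂ V] [AddCommGroup V'] [Module ℂ V']
    [AddCommGroup W] [Module ℂ W] [AddCommGroup W'] [Module ℂ W']
    {ρ : Representation ℂ G V} {ρ' : Representation ℂ G V'}
    {σ : Representation ℂ G W} {σ' : Representation ℂ G W'}
    (φ : ρ.Equiv ρ') (ψ : σ.Equiv σ') : (ρ.prod σ).Equiv (ρ'.prod σ') :=
  Representation.Equiv.mk (φ.toLinearEquiv.prodCongr ψ.toLinearEquiv) (by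
    intro g
    refine LinearMap.ext fun x => Prod.ext ?_ ?_
    · exact IntertwiningMap.isIntertwining _ _ φ.toIntertwiningMap g x.1
    · exact IntertwiningMap.isIntertwining _ _ ψ.toIntertwiningMap g x.2)

/-- A complement of the kernel of an intertwining map is isomorphic to its range. -/
lemma Representation.IntertwiningMap.nonempty_equiv_range {V : Type v} {W : Type w}
    [AddCommGroup V] [Module ℂ V] [AddCommGroup W] [Module ℂ W]
    {ρ : Representation ℂ G V} {σ : Representation ℂ G W} (f : IntertwiningMap ρ σ)
    (q : Subrepresentation ρ) (h : IsCompl f.ker q) :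
    Nonempty (q.toRepresentation.Equiv f.range.toRepresentation) := by
  have h1 : IsCompl f.toLinearMap.ker q.toSubmodule :=
      ⟨disjoint_iff.2 (congrArg Subrepresentation.toSubmodule h.1.eq_bot),
        codisjoint_iff.2 (congrArg Subrepresentation.toSubmodule h.2.eq_top)⟩
  let g : q.toSubmodule →ₗ[ℂ] f.range.toSubmodule :=
    (f.toLinearMap.domRestrict q.toSubmodule).codRestrict _ fun x => ⟨x.1, rfl⟩
  have hinj : Function.Injective g := by
    rw [← LinearMap.ker_eq_bot, LinearMap.ker_eq_bot']
    intro x hx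
    have hx' : f.toLinearMap x.1 = 0 := congrArg Subtype.val hx
    have : x.1 ∈ f.toLinearMap.ker ⊓ q.toSubmodule := ⟨hx', x.2⟩
    rw [h1.inf_eq_bot] at this
    exact Subtype.ext this
  have hsurj : Function.Surjective g := by
    rintro ⟨_, v, rfl⟩
    have : v ∈ f.toLinearMap.ker ⊔ q.toSubmodule := h1.sup_eq_top ▸ Submodule.mem_top
    obtain ⟨a, ha, b, hb, rfl⟩ := Submodule.mem_sup.1 this
    refine ⟨⟨b, hb⟩, Subtype.ext ?_⟩
    change f.toLinearMap b = f.toLinearMap (a + b)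
    rw [map_add, LinearMap.mem_ker.1 ha, zero_add]
  refine ⟨Representation.Equiv.mk (LinearEquiv.ofBijective g ⟨hinj, hsurj⟩) fun γ => ?_⟩
  refine LinearMap.ext fun x => Subtype.ext ?_
  exact IntertwiningMap.isIntertwining _ _ f γ x.1

variable [Finite G]

/-- Induction on the dimension. By orthogonality `dim Hom(ρ, σ)` depends only on the characters, so
it equals `dim End(ρ) > 0`. A nonzero intertwiner identifies a complement of its kernel with its
range; cancelling this common summand leaves the kernel and a complement of the range, of smaller
dimension and equal characters. -/
lemma Representation.nonempty_equiv_of_finrank_eq (n : ℕ) :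
    ∀ (V : Type v) (W : Type w) [AddCommGroup V] [Module ℂ V] [Module.Finite ℂ V]
      [AddCommGroup W] [Module ℂ W] [Module.Finite ℂ W]
      (ρ : Representation ℂ G V) (σ : Representation ℂ G W),
      finrank ℂ V = n → ρ.character = σ.character → Nonempty (ρ.Equiv σ) := by
  have := Fintype.ofFinite G
  have : NeZero (Nat.card G : ℂ) := ⟨Nat.cast_ne_zero.2 Nat.card_pos.ne'⟩
  have : Invertible (Nat.card G : ℂ) := invertibleOfNonzero (NeZero.ne _)
  induction n using Nat.strong_induction_on with
  | _ n ih =>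
    intro V W _ _ _ _ _ _ ρ σ hn hχ
    have hdim : finrank ℂ V = finrank ℂ W := by
      have := congrFun hχ 1
      rw [char_one, char_one] at this
      exact_mod_cast this
    rcases Nat.eq_zero_or_pos n with h0 | hpos
    · have hV : Subsingleton V := finrank_zero_iff.1 (hn.trans h0)
      have hW : Subsingleton W := finrank_zero_iff.1 (hdim.symm.trans (hn.trans h0))
      exact ⟨Representation.Equiv.mk (0 : V ≃ₗ[ℂ] W)
        fun g => LinearMap.ext fun x => Subsingleton.elim _ _⟩
    · have hVn : Nontrivial V := nontrivial_of_finrank_pos (R := ℂ) (hn ▸ hpos)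
      have hHom : finrank ℂ (IntertwiningMap ρ σ) ≠ 0 := by
        have h1 := card_inv_mul_sum_char_mul_char_eq_finrank ρ σ
        have h2 := card_inv_mul_sum_char_mul_char_eq_finrank ρ ρ
        rw [← hχ, h2] at h1
        have h3 : finrank ℂ (IntertwiningMap ρ ρ) = finrank ℂ (IntertwiningMap ρ σ) := by
          exact_mod_cast h1
        rw [← h3]
        have : Nontrivial (IntertwiningMap ρ ρ) := by
          obtain ⟨x, hx⟩ := exists_ne (0 : V)
          exact ⟨IntertwiningMap.id ρ, 0, fun h => hx (DFunLike.congr_fun h x)⟩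
        exact finrank_pos.ne'
      obtain ⟨f, hf⟩ : ∃ f : IntertwiningMap ρ σ, f ≠ 0 := by
        by_contra! h
        have : Subsingleton (IntertwiningMap ρ σ) := ⟨fun a b => (h a).trans (h b).symm⟩
        exact hHom finrank_zero_of_subsingleton
      obtain ⟨q, hq⟩ := exists_isCompl f.ker
      obtain ⟨r, hr⟩ := exists_isCompl f.range
      obtain ⟨e⟩ := f.nonempty_equiv_range q hq
      have e1 := Subrepresentation.prodEquivOfIsCompl _ _ hq
      have e2 := Subrepresentation.prodEquivOfIsCompl _ _ hr.symm
      have hch : f.ker.toRepresentation.character = r.toRepresentation.character := by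
        funext g
        have h1 := congrFun (char_iso e1) g
        have h2 := congrFun (char_iso e2) g
        have h3 := congrFun (char_iso e) g
        rw [character_prod] at h1 h2
        rw [h3, congrFun hχ g, ← h2] at h1
        exact add_right_cancel h1
      have hlt : finrank ℂ f.ker.toSubmodule < n := by
        rw [← hn]
        refine Submodule.finrank_lt fun htop => hf ?_
        refine IntertwiningMap.ext (LinearMap.ext fun x => ?_)
        have : x ∈ f.ker.toSubmodule := htop ▸ Submodule.mem_top
        exact this
      obtain ⟨e3⟩ := ih _ hlt _ _ f.ker.toRepresentation r.toRepresentation rfl hch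
      exact ⟨e1.symm.trans ((e3.prodCongr e).trans e2)⟩

/-- Finite-dimensional complex representations of a finite group with equal characters are
isomorphic. -/
theorem Representation.nonempty_equiv_of_character_eq {V : Type v} {W : Type w}
    [AddCommGroup V] [Module ℂ V] [Module.Finite ℂ V]
    [AddCommGroup W] [Module ℂ W] [Module.Finite ℂ W]
    {ρ : Representation ℂ G V} {σ : Representation ℂ G W} (h : ρ.character = σ.character) :
    Nonempty (ρ.Equiv σ) :=
  nonempty_equiv_of_finrank_eq _ V W ρ σ rfl h

end Characters

/-! ### The Frobenius-Schur indicator and Gelfand models -/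

section FrobeniusSchur

open Representation Module

-- The diagonal entries of the flip composed with `f ⊗ g` are products of transposed entries of `f`
-- and `g`. For `f = g = τ(h)` this makes `χ_τ(h²)` a trace on `V ⊗ V`.
open scoped TensorProduct in
lemma LinearMap.trace_comm_comp_map {V : Type*} [AddCommGroup V] [Module ℂ V]
    [Module.Finite ℂ V] (f g : V →ₗ[ℂ] V) :
    LinearMap.trace ℂ (V ⊗[ℂ] V)
      ((TensorProduct.comm ℂ V V).toLinearMap ∘ₗ TensorProduct.map f g) =
      LinearMap.trace ℂ V (f ∘ₗ g) := by
  classical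
  let b := finBasis ℂ V
  rw [LinearMap.trace_eq_matrix_trace ℂ (b.tensorProduct b), LinearMap.trace_eq_matrix_trace ℂ b,
    LinearMap.toMatrix_comp b b b, Matrix.trace, Fintype.sum_prod_type, Matrix.trace,
    Finset.sum_comm]
  refine Finset.sum_congr rfl fun i _ => ?_
  rw [Matrix.diag_apply, Matrix.mul_apply]
  refine Finset.sum_congr rfl fun j _ => ?_
  simp [LinearMap.toMatrix_apply]

variable {G : Type*} [Group G] [Fintype G]

/-- The character is real, so by Schur's lemma the invariants of `V ⊗ V` form a line. The flip
preserves this line and squares to the identity, hence acts on it by `c = 1` or `c = -1`. The trace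
of the flip composed with the averaging projection is `c`; computed term by term it is the average
of `χ_τ(g²)`. -/
theorem Representation.IsIrreducible.sum_character_sq_eq_or {V : Type*} [AddCommGroup V]
    [Module ℂ V] [Module.Finite ℂ V] (τ : Representation ℂ G V) [τ.IsIrreducible]
    (hG : ∀ g : G, IsConj g g⁻¹) :
    (Nat.card G : ℂ)⁻¹ * ∑ g : G, τ.character (g ^ 2) = 1 ∨
      (Nat.card G : ℂ)⁻¹ * ∑ g : G, τ.character (g ^ 2) = -1 := by
  have : Invertible (Nat.card G : ℂ) :=
    invertibleOfNonzero (Nat.cast_ne_zero.2 Nat.card_pos.ne')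
  have : Invertible (Fintype.card G : ℂ) := by rw [Fintype.card_eq_nat_card]; assumption
  have hreal : ∀ g, τ.character g⁻¹ = τ.character g := by
    intro g
    obtain ⟨c, hc⟩ := isConj_iff.1 (hG g)
    rw [← hc, char_conj]
  have hone : finrank ℂ (invariants (tprod τ τ)) = 1 := by
    have h1 := card_inv_mul_sum_char_eq_finrank (tprod τ τ)
    have h2 := card_inv_mul_sum_char_mul_char_eq_finrank τ τ
    rw [IsIrreducible.finrank_intertwiningMap_self] at h2
    simp only [char_tensor, Pi.mul_apply] at h1
    simp only [hreal] at h2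
    rw [h2] at h1
    exact_mod_cast h1.symm
  obtain ⟨b, hb0, hb⟩ := finrank_eq_one_iff'.1 hone
  let T := (_root_.TensorProduct.comm ℂ V V).toLinearMap
  have hT : ∀ x, T (T x) = x := fun x => (_root_.TensorProduct.comm ℂ V V).symm_apply_apply x
  have hTinv : T b.1 ∈ invariants (tprod τ τ) := by
    intro g
    have h : T ∘ₗ tprod τ τ g = tprod τ τ g ∘ₗ T := TensorProduct.ext' fun x y => rfl
    rw [← LinearMap.comp_apply, ← h, LinearMap.comp_apply, b.2 g]
  obtain ⟨c, hc⟩ := hb ⟨_, hTinv⟩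
  have hc' : c • b.1 = T b.1 := congrArg Subtype.val hc
  have hbne : b.1 ≠ 0 := fun h => hb0 (Subtype.ext h)
  have hcc : c * c = 1 := by
    have h1 := hT b.1
    rw [← hc', map_smul, ← hc', smul_smul] at h1
    have h2 : (c * c - 1) • b.1 = 0 := by rw [sub_smul, h1, one_smul, sub_self]
    exact sub_eq_zero.1 ((smul_eq_zero.1 h2).resolve_right hbne)
  -- The projection takes values in the invariant line, on which the flip is multiplication by `c`.
  have hTP : T ∘ₗ averageMap (tprod τ τ) = c • averageMap (tprod τ τ) := by
    refine LinearMap.ext fun x => ?_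
    obtain ⟨d, hd⟩ := hb ⟨_, averageMap_invariant (tprod τ τ) x⟩
    have hd' : d • b.1 = averageMap (tprod τ τ) x := congrArg Subtype.val hd
    rw [LinearMap.comp_apply, LinearMap.smul_apply, ← hd', map_smul, ← hc', smul_comm]
  have htr := congrArg (LinearMap.trace ℂ _) hTP
  rw [map_smul, (isProj_averageMap (tprod τ τ)).trace, hone] at htr
  have hsum : LinearMap.trace ℂ _ (T ∘ₗ averageMap (tprod τ τ)) =
      (Nat.card G : ℂ)⁻¹ * ∑ g : G, τ.character (g ^ 2) := by
    simp only [averageMap, GroupAlgebra.average, map_smul, _root_.map_sum, asAlgebraHom_of,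
      LinearMap.comp_smul]
    rw [invOf_eq_inv, Fintype.card_eq_nat_card, smul_eq_mul]
    congr 1
    have h : T ∘ₗ ∑ g, tprod τ τ g = ∑ g, T ∘ₗ tprod τ τ g := by
      refine LinearMap.ext fun x => ?_
      simp
    rw [h, _root_.map_sum]
    refine Finset.sum_congr rfl fun g _ => ?_
    rw [pow_two, character, map_mul]
    exact LinearMap.trace_comm_comp_map (τ g) (τ g)
  rw [hsum] at htr
  rw [htr]
  simp only [Nat.cast_one, smul_eq_mul, mul_one]
  exact mul_self_eq_one_iff.1 hcc

open scoped Classical in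
/-- A representation whose character counts square roots is a Gelfand model, if every element of
the group is conjugate to its inverse. -/
theorem IsGelfandModel.of_character_eq_card_sqrt {G : Type u} [Group G] [Fintype G]
    {M : Type v} [AddCommGroup M] [Module ℂ M] [Module.Finite ℂ M] (ρ : Representation ℂ G M)
    (hG : ∀ g : G, IsConj g g⁻¹)
    (hρ : ∀ g : G, ρ.character g = ({h : G | h ^ 2 = g} : Finset G).card) :
    IsGelfandModel ρ := by
  refine ⟨inferInstance, fun V _ _ _ τ hτ => ?_⟩
  have : Invertible (Nat.card G : ℂ) :=
    invertibleOfNonzero (Nat.cast_ne_zero.2 Nat.card_pos.ne')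
  have h1 := card_inv_mul_sum_char_mul_char_eq_finrank τ ρ
  have h2 : ∑ g : G, ρ.character g * τ.character g⁻¹ = ∑ g : G, τ.character (g ^ 2) := by
    simp_rw [hρ, Finset.card_filter, Nat.cast_sum, Finset.sum_mul]
    rw [Finset.sum_comm]
    -- Replacing `h` by `h⁻¹` compensates the inverse in `χ_τ(g⁻¹)` at `g = h²`.
    rw [← Equiv.sum_comp (Equiv.inv G)]
    refine Finset.sum_congr rfl fun h _ => ?_
    rw [Finset.sum_eq_single ((h⁻¹) ^ 2)]
    · simp
    · intro g _ hg
      have hg' : (h ^ 2)⁻¹ ≠ g := fun h' => hg (by rw [← h', inv_pow])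
      simp [hg']
    · simp
  rw [h2] at h1
  -- The value `-1` is impossible, since the average is here the dimension of a space of
  -- intertwiners.
  rcases IsIrreducible.sum_character_sq_eq_or τ hG with h | h
  · rw [h] at h1
    exact_mod_cast h1.symm
  · rw [h] at h1
    exfalso
    have : ((finrank ℂ (IntertwiningMap τ ρ) + 1 : ℕ) : ℂ) = 0 := by
      push_cast
      rw [← h1]
      ring
    exact Nat.succ_ne_zero _ (Nat.cast_eq_zero.1 this)

end FrobeniusSchur

/-! ### Characters of induced representations -/

section InducedCharacters

open Representation Module

/-- Averaging factors through the coinvariants as a section `s` of the quotient map `p`, with `p s =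
1` and `s p` the averaging map; the trace is then moved to `V` cyclically. -/
lemma Representation.trace_coinvariants_map {H V : Type*} [Group H] [Fintype H]
    [Invertible (Fintype.card H : ℂ)] [AddCommGroup V] [Module ℂ V] [Module.Finite ℂ V]
    (π : Representation ℂ H V) (f : IntertwiningMap π π) :
    LinearMap.trace ℂ _ (Coinvariants.map π π f) =
      LinearMap.trace ℂ V (f.toLinearMap ∘ₗ averageMap π) := by
  have hs : ∀ h, averageMap π ∘ₗ π h = averageMap π := by
    intro h
    rw [averageMap, ← asAlgebraHom_single_one, ← Module.End.mul_eq_comp, ← map_mul,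
      GroupAlgebra.mul_average_right]
  let s := Coinvariants.lift π (averageMap π) hs
  have hps : Coinvariants.mk π ∘ₗ s = LinearMap.id := by
    refine Coinvariants.hom_ext (LinearMap.ext fun x => ?_)
    simp only [s, LinearMap.comp_apply, Coinvariants.lift_mk, LinearMap.id_apply, averageMap,
      GroupAlgebra.average, map_smul, _root_.map_sum, LinearMap.smul_apply, LinearMap.sum_apply,
      asAlgebraHom_of, Coinvariants.mk_self_apply]
    rw [Finset.sum_const, Finset.card_univ, ← Nat.cast_smul_eq_nsmul ℂ, smul_smul, invOf_mul_self,
      one_smul]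
  have hsp : s ∘ₗ Coinvariants.mk π = averageMap π := rfl
  rw [← LinearMap.comp_id (Coinvariants.map π π f), ← hps, ← LinearMap.comp_assoc,
    Coinvariants.map_comp_mk, LinearMap.comp_assoc, LinearMap.trace_comp_comm',
    LinearMap.comp_assoc, hsp]
  rfl

instance {G : Type*} [Group G] [Finite G] : Module.Finite ℂ (MonoidAlgebra ℂ G) :=
  Module.Finite.of_basis (MonoidAlgebra.basis G ℂ)

/-- The operator permutes the basis by `x ↦ h x γ⁻¹`, so its trace counts fixed points. -/
lemma MonoidAlgebra.trace_mapDomain_comp_ofMulAction {G : Type*} [Group G] [Fintype G]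
    [DecidableEq G] (h γ : G) :
    LinearMap.trace ℂ _ ((MonoidAlgebra.mapDomainLinearMap ℂ ℂ fun x => x * γ⁻¹) ∘ₗ
      leftRegular ℂ G h) = ({x : G | x * γ * x⁻¹ = h} : Finset G).card := by
  rw [LinearMap.trace_eq_matrix_trace ℂ (MonoidAlgebra.basis G ℂ), Matrix.trace,
    Finset.card_filter, Nat.cast_sum]
  refine Finset.sum_congr rfl fun x _ => ?_
  have hx : h * x * γ⁻¹ = x ↔ x * γ * x⁻¹ = h := by
    rw [mul_inv_eq_iff_eq_mul, mul_inv_eq_iff_eq_mul, eq_comm]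
  have hr : (MonoidAlgebra.basis G ℂ).repr (MonoidAlgebra.single (h * x * γ⁻¹) 1) =
      Finsupp.single (h * x * γ⁻¹) 1 := (MonoidAlgebra.basis G ℂ).repr_self _
  simp [LinearMap.toMatrix_apply, hr, Finsupp.single_apply, hx]

/-- The Frobenius formula. Induction is realised as the `H`-coinvariants of a tensor product of the
group algebra and the character space, so the trace is an average over `H` of products of two
traces. -/
theorem character_indChar {G : Type u} [Group G] [Fintype G] [DecidableEq G] (H : Subgroup G)
    [Fintype H] (χ : H →* ℂˣ) (γ : G) :
    (indChar H χ).character γ = (Fintype.card H : ℂ)⁻¹ *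
      ∑ h : H, (χ h : ℂ) * ({x : G | x * γ * x⁻¹ = h} : Finset G).card := by
  have : Invertible (Fintype.card H : ℂ) :=
    invertibleOfNonzero (Nat.cast_ne_zero.2 Fintype.card_ne_zero)
  rw [character, indChar, ind_apply, trace_coinvariants_map]
  simp only [averageMap, GroupAlgebra.average, map_smul, _root_.map_sum, asAlgebraHom_of,
    LinearMap.comp_smul]
  rw [invOf_eq_inv, smul_eq_mul]
  congr 1
  have h : ∀ (V : Type u) [AddCommGroup V] [Module ℂ V] (f : V →ₗ[ℂ] V) (g : H → V →ₗ[ℂ] V),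
      f ∘ₗ ∑ h, g h = ∑ h, f ∘ₗ g h := by
    intro V _ _ f g
    refine LinearMap.ext fun x => ?_
    simp
  rw [h, _root_.map_sum]
  refine Finset.sum_congr rfl fun h _ => ?_
  rw [← MonoidAlgebra.trace_mapDomain_comp_ofMulAction (h : G) γ, mul_comm]
  have : LinearMap.trace ℂ ℂ (linearCharRep χ h) = χ h := by
    simp [linearCharRep]
  rw [← this, ← LinearMap.trace_tensorProduct']
  congr 1
  ext
  simp

-- The Frobenius formula as a sum over fixed points in the orbit: `k ↦ k • x` has fibres of the size
-- of the stabilizer, which cancels the normalising factor. The function `Φ` carries the conjugates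
-- of `χ` along the orbit.
open scoped Classical in
theorem character_indChar_stabilizer {G : Type u} {X : Type v} [Group G] [Fintype G]
    [MulAction G X] [Fintype X]
    (x : X) (χ : MulAction.stabilizer G x →* ℂˣ) (γ : G) (Φ : X → ℂ)
    (hΦ : ∀ (k : G) (h : k⁻¹ * γ * k ∈ MulAction.stabilizer G x), Φ (k • x) = χ ⟨_, h⟩) :
    (indChar (MulAction.stabilizer G x) χ).character γ =
      ∑ y : X with y ∈ MulAction.orbit G x ∧ γ • y = y, Φ y := by
  have hfix : ∀ k : G, k⁻¹ * γ * k ∈ MulAction.stabilizer G x ↔ γ • k • x = k • x := by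
    intro k
    rw [MulAction.mem_stabilizer_iff, mul_smul, mul_smul, inv_smul_eq_iff]
  rw [character_indChar, inv_mul_eq_iff_eq_mul₀ (Nat.cast_ne_zero.2 Fintype.card_ne_zero)]
  have h1 : ∑ h : MulAction.stabilizer G x, (χ h : ℂ) *
      ({y : G | y * γ * y⁻¹ = h} : Finset G).card =
      ∑ k : G, if γ • k • x = k • x then Φ (k • x) else 0 := by
    rw [← Equiv.sum_comp (Equiv.inv G)]
    simp_rw [Finset.card_filter, Nat.cast_sum, Finset.mul_sum]
    rw [Finset.sum_comm]
    refine Finset.sum_congr rfl fun k _ => ?_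
    by_cases hk : γ • k⁻¹ • x = k⁻¹ • x
    · have hk' := (hfix k⁻¹).2 hk
      rw [Equiv.inv_apply, if_pos hk, hΦ _ hk', Finset.sum_eq_single ⟨_, hk'⟩]
      · simp
      · intro h _ hne
        have : k * γ * k⁻¹ ≠ h := fun h' => hne (Subtype.ext (by simp [← h']))
        simp [this]
      · simp
    · rw [Equiv.inv_apply, if_neg hk]
      refine Finset.sum_eq_zero fun h _ => ?_
      have : k * γ * k⁻¹ ≠ h := fun h' => hk ((hfix k⁻¹).1 (by
        rw [inv_inv, h']
        exact h.2))
      simp [this]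
  rw [h1, Finset.mul_sum, Finset.sum_filter,
    ← Finset.sum_fiberwise (s := Finset.univ) (g := fun k : G => k • x)]
  refine Finset.sum_congr rfl fun y _ => ?_
  rw [Finset.sum_filter]
  by_cases hy : y ∈ MulAction.orbit G x
  · obtain ⟨k, rfl⟩ := hy
    simp only [MulAction.mem_orbit, true_and]
    -- The fibre over `k • x` is the coset of the stabilizer represented by `k`.
    have hcard : ({a : G | a • x = k • x} : Finset G).card =
        Fintype.card (MulAction.stabilizer G x) := by
      rw [← Finset.card_univ]
      symm
      refine Finset.card_bij (fun h _ => k * h.1) ?_ ?_ ?_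
      · intro h _
        have hx : (h : G) • x = x := h.2
        simp [mul_smul, hx]
      · intro a _ b _ hab
        exact Subtype.ext (mul_left_cancel hab)
      · intro a ha
        rw [Finset.mem_filter] at ha
        exact ⟨⟨k⁻¹ * a, by rw [MulAction.mem_stabilizer_iff, mul_smul, ha.2, inv_smul_smul]⟩,
          Finset.mem_univ _, by simp⟩
    rw [← Finset.sum_filter, Finset.sum_congr rfl (g := fun _ => if γ • k • x = k • x then
      Φ (k • x) else 0), Finset.sum_const, hcard, nsmul_eq_mul]
    · split_ifs <;> simp
    · intro a ha
      rw [(Finset.mem_filter.1 ha).2]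
  · rw [if_neg (c := y ∈ MulAction.orbit G x ∧ γ • y = y) (fun h => hy h.1)]
    refine Finset.sum_eq_zero fun k _ => ?_
    rw [if_neg]
    rintro rfl
    exact hy (MulAction.mem_orbit _ _)

lemma LinearMap.trace_pi {ι : Type*} [Fintype ι] [DecidableEq ι] {V : ι → Type*}
    [∀ i, AddCommGroup (V i)] [∀ i, Module ℂ (V i)] [∀ i, Module.Finite ℂ (V i)]
    (T : (∀ i, V i) →ₗ[ℂ] (∀ i, V i)) :
    LinearMap.trace ℂ _ T = ∑ i, LinearMap.trace ℂ (V i)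
      (LinearMap.proj i ∘ₗ T ∘ₗ LinearMap.single ℂ V i) := by
  have h : T = ∑ i, (T ∘ₗ LinearMap.single ℂ V i) ∘ₗ LinearMap.proj i := by
    refine LinearMap.ext fun x => ?_
    conv_lhs => rw [← Finset.univ_sum_single x]
    simp
  conv_lhs => rw [h]
  rw [_root_.map_sum]
  exact Finset.sum_congr rfl fun i _ => LinearMap.trace_comp_comm' _ _

open scoped Classical in
/-- The character of the representation of `G` induced from a representation of the action
groupoid by one-dimensional spaces. -/
theorem character_groupoidInd {G : Type u} {X : Type v} [Group G] [MulAction G X] [Fintype X]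
    (σ : ActionCategory G X ⥤ FGModuleCat.{w} ℂ)
    (h1 : ∀ x : X, finrank ℂ (σ.obj (groupoidPt G x)) = 1) (g : G) (Φ : X → ℂ)
    (hΦ : ∀ (x : X) (h : g • x = x),
      (σ.map (groupoidArrow g h)).hom.hom = Φ x • LinearMap.id) :
    (groupoidInd σ).character g = ∑ x : X with g • x = x, Φ x := by
  rw [character, LinearMap.trace_pi, Finset.sum_filter]
  refine Finset.sum_congr rfl fun x _ => ?_
  split_ifs with hx
  · have : LinearMap.proj x ∘ₗ groupoidInd σ g ∘ₗ LinearMap.single ℂ _ x =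
        Φ x • LinearMap.id := by
      rw [← hΦ x hx]
      refine LinearMap.ext fun v => ?_
      change groupoidIndAux σ g (Pi.single x v) x = _
      rw [groupoidIndAux_apply σ g _ hx, Pi.single_eq_same]
    rw [this, map_smul, LinearMap.trace_id, h1]
    simp
  · have : LinearMap.proj x ∘ₗ groupoidInd σ g ∘ₗ LinearMap.single ℂ _ x =
        (0 : σ.obj (groupoidPt G x) →ₗ[ℂ] σ.obj (groupoidPt G x)) := by
      refine LinearMap.ext fun v => ?_
      change groupoidIndAux σ g (Pi.single x v) x = 0
      have hne : g⁻¹ • x ≠ x := fun h => hx (inv_smul_eq_iff.1 h).symm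
      rw [groupoidIndAux_apply σ g _ (smul_inv_smul g x), Pi.single_eq_of_ne hne, map_zero]
    rw [this, map_zero]

end InducedCharacters

/-! ### Extension of characters of the isotropy groups to the action groupoid -/

section Extension

variable {G : Type u} {X : Type v} [Group G] [MulAction G X]

/-- The representation of the action groupoid by copies of `ℂ` given by a `1`-cocycle. -/
noncomputable def groupoidRepOfCocycle (c : G → X → ℂˣ) (h1 : ∀ x, c 1 x = 1)
    (hmul : ∀ g h x, c (g * h) x = c g (h • x) * c h x) :
    ActionCategory G X ⥤ FGModuleCat.{w} ℂ where
  obj _ := FGModuleCat.of ℂ (ULift.{w} ℂ)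
  map {a _} f := FGModuleCat.ofHom ((c f.1 a.back : ℂ) • LinearMap.id)
  map_id a := by
    have : c (𝟙 a : a ⟶ a).1 a.back = 1 := h1 _
    rw [this, Units.val_one, one_smul]
    rfl
  map_comp {a b d} f g := by
    have hb : f.1 • a.back = b.back := f.2
    have : c (f ≫ g).1 a.back = c g.1 b.back * c f.1 a.back := by
      rw [← hb]
      exact hmul _ _ _
    rw [this]
    refine FGModuleCat.hom_ext (LinearMap.ext fun x => ?_)
    change ((c g.1 b.back * c f.1 a.back : ℂˣ) : ℂ) • x = (c g.1 b.back : ℂ) • (c f.1 a.back : ℂ) • x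
    rw [smul_smul, Units.val_mul]

/-- A family of linear characters of the isotropy groups which is compatible with conjugation
extends to the action groupoid. -/
theorem exists_groupoidRep (ε : ∀ x : X, MulAction.stabilizer G x →* ℂˣ)
    (hε : ∀ (k : G) (x : X) (h : MulAction.stabilizer G (k • x))
      (h' : k⁻¹ * h * k ∈ MulAction.stabilizer G x), ε (k • x) h = ε x ⟨_, h'⟩) :
    ∃ σ : ActionCategory G X ⥤ FGModuleCat.{w} ℂ,
      (∀ x : X, Module.finrank ℂ (σ.obj (groupoidPt G x)) = 1) ∧
      ∀ (x : X) (h : MulAction.stabilizer G x),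
        (σ.map (groupoidArrow (h : G) h.2)).hom.hom = (ε x h : ℂ) • LinearMap.id := by
  classical
  -- One base point `r x` per orbit, and below for each `x` an element `k x` carrying the base point
  -- to `x`.
  let r : X → X := fun x => (Quotient.mk (MulAction.orbitRel G X) x).out
  have hr : ∀ (g : G) (x : X), r (g • x) = r x := fun g x => by
    have : Quotient.mk (MulAction.orbitRel G X) (g • x) = Quotient.mk _ x :=
      Quotient.sound (MulAction.mem_orbit x g)
    simp only [r, this]
  have hk : ∀ x, ∃ k : G, k • r x = x := fun x => by
    have : MulAction.orbitRel G X (r x) x := Quotient.mk_out (s := MulAction.orbitRel G X) x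
    obtain ⟨k, hk⟩ := (MulAction.orbitRel G X).symm this
    exact ⟨k, hk⟩
  choose k hk using hk
  -- Extension by `1` outside the stabilizer, a value that is never used; it only frees the cocycle
  -- from membership proofs.
  let e : X → G → ℂˣ := fun y g =>
    if h : g ∈ MulAction.stabilizer G y then ε y ⟨g, h⟩ else 1
  have he : ∀ y g (h : g ∈ MulAction.stabilizer G y), e y g = ε y ⟨g, h⟩ := fun y g h => dif_pos h
  have hmem : ∀ g x, (k (g • x))⁻¹ * g * k x ∈ MulAction.stabilizer G (r x) := fun g x => by
    rw [MulAction.mem_stabilizer_iff, mul_smul, mul_smul, hk, inv_smul_eq_iff]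
    conv_lhs => rw [← hk (g • x), hr]
  -- The arrow from `x` to `g • x` is closed up to a loop at the base point, where `ε` is defined.
  -- Loops compose, so `c` is a cocycle.
  let c : G → X → ℂˣ := fun g x => e (r x) ((k (g • x))⁻¹ * g * k x)
  have hc : ∀ (x : X) (h : MulAction.stabilizer G x), c h x = ε x h := by
    intro x h
    have hx : (h : G) • x = x := h.2
    have h1 := hmem h x
    rw [hx] at h1
    simp only [c, hx]
    rw [he _ _ h1]
    have key : ∀ (y : X) (hy : k x • r x = y) (h : MulAction.stabilizer G y)
        (h1 : (k x)⁻¹ * h * k x ∈ MulAction.stabilizer G (r x)), ε (r x) ⟨_, h1⟩ = ε y h := by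
      rintro _ rfl h h1
      exact (hε _ _ _ _).symm
    exact key x (hk x) h h1
  refine ⟨groupoidRepOfCocycle c ?_ ?_, fun x => ?_, fun x h => ?_⟩
  · intro x
    have := hc x 1
    rw [map_one] at this
    exact this
  · intro g h x
    have h1 := hmem g (h • x)
    rw [hr] at h1
    have h2 := hmem h x
    have h3 := hmem (g * h) x
    simp only [c]
    rw [hr, he _ _ h1, he _ _ h2, he _ _ h3, ← map_mul]
    congr 1
    refine Subtype.ext ?_
    simp [mul_smul, mul_assoc]
  · change Module.finrank ℂ (ULift.{w} ℂ) = 1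
    simp
  · rw [← hc]
    rfl

end Extension

/-! ### Form classes as matrices up to scalars -/

section FormMatrix

open Matrix

variable {F : Type u} [Field F]

/-- The standard area form on the plane. -/
def planeArea (u w : Fin 2 → F) : F := u 0 * w 1 - u 1 * w 0

/-- The bilinear form `(u, v) ↦ ω (u, A v)`, where `ω` is the area form. -/
def areaBilin (A : Matrix (Fin 2) (Fin 2) F) : LinearMap.BilinForm F (Fin 2 → F) :=
  LinearMap.mk₂ F (fun u v => planeArea u (A *ᵥ v))
    (by intros; simp only [planeArea, Pi.add_apply]; ring)
    (by intros; simp only [planeArea, Pi.smul_apply, smul_eq_mul]; ring)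
    (by intros; simp only [planeArea, Matrix.mulVec_add, Pi.add_apply]; ring)
    (by intros; simp only [planeArea, Matrix.mulVec_smul, Pi.smul_apply, smul_eq_mul]; ring)

lemma areaBilin_apply (A : Matrix (Fin 2) (Fin 2) F) (u v : Fin 2 → F) :
    areaBilin A u v = planeArea u (A *ᵥ v) := rfl

lemma areaBilin_eq (A : Matrix (Fin 2) (Fin 2) F) (u v : Fin 2 → F) :
    areaBilin A u v =
      u 0 * (A 1 0 * v 0 + A 1 1 * v 1) - u 1 * (A 0 0 * v 0 + A 0 1 * v 1) := by
  simp [areaBilin_apply, planeArea, Matrix.mulVec, dotProduct, Fin.sum_univ_two]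

/-- The matrix `A` of a bilinear form on the plane such that `B (u, v) = ω (u, A v)`. -/
def formMatrix (B : LinearMap.BilinForm F (Fin 2 → F)) : Matrix (Fin 2) (Fin 2) F :=
  !![-B (Pi.single 1 1) (Pi.single 0 1), -B (Pi.single 1 1) (Pi.single 1 1);
    B (Pi.single 0 1) (Pi.single 0 1), B (Pi.single 0 1) (Pi.single 1 1)]

@[simp]
lemma areaBilin_formMatrix (B : LinearMap.BilinForm F (Fin 2 → F)) :
    areaBilin (formMatrix B) = B := by
  refine LinearMap.ext fun u => LinearMap.ext fun v => ?_
  have h : ∀ w : Fin 2 → F, w = w 0 • Pi.single 0 1 + w 1 • Pi.single 1 1 := by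
    intro w
    ext i
    fin_cases i <;> simp
  rw [areaBilin_eq]
  conv_rhs => rw [h u, h v]
  simp only [formMatrix, map_add, map_smul, LinearMap.add_apply, LinearMap.smul_apply,
    smul_eq_mul, Matrix.of_apply, Matrix.cons_val_zero, Matrix.cons_val_one, Matrix.cons_val']
  simp
  ring

@[simp]
lemma formMatrix_areaBilin (A : Matrix (Fin 2) (Fin 2) F) : formMatrix (areaBilin A) = A := by
  ext i j
  fin_cases i <;> fin_cases j <;> simp [formMatrix, areaBilin_eq]

lemma areaBilin_injective : Function.Injective (areaBilin (F := F)) :=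
  Function.LeftInverse.injective formMatrix_areaBilin

lemma areaBilin_smul (c : F) (A : Matrix (Fin 2) (Fin 2) F) :
    areaBilin (c • A) = c • areaBilin A := by
  refine LinearMap.ext fun u => LinearMap.ext fun v => ?_
  simp only [LinearMap.smul_apply, areaBilin_eq, Matrix.smul_apply, smul_eq_mul]
  ring

lemma formMatrix_smul (c : F) (B : LinearMap.BilinForm F (Fin 2 → F)) :
    formMatrix (c • B) = c • formMatrix B :=
  areaBilin_injective (by rw [areaBilin_smul]; simp)

lemma areaBilin_nondegenerate_iff (A : Matrix (Fin 2) (Fin 2) F) :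
    (areaBilin A).Nondegenerate ↔ A.det ≠ 0 := by
  have harea : ∀ w : Fin 2 → F, (∀ u, planeArea u w = 0) → w = 0 := by
    intro w h
    have h0 := h (Pi.single 0 1)
    have h1 := h (Pi.single 1 1)
    simp [planeArea] at h0 h1
    ext i
    fin_cases i
    · exact h1
    · exact h0
  have harea' : ∀ u : Fin 2 → F, (∀ w, planeArea u w = 0) → u = 0 := by
    intro u h
    have h0 := h (Pi.single 0 1)
    have h1 := h (Pi.single 1 1)
    simp [planeArea] at h0 h1
    ext i
    fin_cases i
    · exact h1
    · exact h0
  constructor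
  · intro h hdet
    obtain ⟨v, hv, hAv⟩ := Matrix.exists_mulVec_eq_zero_iff.2 hdet
    refine hv (h.2 v fun u => ?_)
    rw [areaBilin_apply, hAv]
    simp [planeArea]
  · intro hdet
    refine ⟨fun u hu => harea' u fun w => ?_, fun v hv => ?_⟩
    · have := hu (A⁻¹ *ᵥ w)
      rwa [areaBilin_apply, Matrix.mulVec_mulVec, Matrix.mul_nonsing_inv _ (isUnit_iff_ne_zero.2 hdet),
        Matrix.one_mulVec] at this
    · by_contra hne
      exact hdet (Matrix.exists_mulVec_eq_zero_iff.1 ⟨v, hne, harea _ hv⟩)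

/-- The reason is the identity `B(u, v) - B(v, u) = tr(A) ω(u, v)`. -/
lemma areaBilin_isSymm_iff (A : Matrix (Fin 2) (Fin 2) F) :
    (areaBilin A).IsSymm ↔ A.trace = 0 := by
  rw [Matrix.trace_fin_two]
  constructor
  · intro h
    have := h.eq (Pi.single 0 1) (Pi.single 1 1)
    simp [areaBilin_eq] at this
    linear_combination this
  · intro h
    refine ⟨fun u v => ?_⟩
    simp only [areaBilin_eq]
    linear_combination (u 0 * v 1 - u 1 * v 0) * h

lemma areaBilin_isAlt_iff (A : Matrix (Fin 2) (Fin 2) F) :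
    (areaBilin A).IsAlt ↔ ∃ c : F, A = c • 1 := by
  constructor
  · intro h
    have h0 := h (Pi.single 0 1)
    have h1 := h (Pi.single 1 1)
    have h2 := h (Pi.single 0 1 + Pi.single 1 1)
    simp [areaBilin_eq] at h0 h1 h2
    rw [h0, h1] at h2
    refine ⟨A 0 0, ?_⟩
    ext i j
    fin_cases i <;> fin_cases j <;> simp [h0, h1]
    linear_combination h2
  · rintro ⟨c, rfl⟩ v
    simp [areaBilin_eq]
    ring

/-- The nondegenerate form with a given invertible matrix. -/
def PlaneForm.ofMatrix (A : Matrix (Fin 2) (Fin 2) F) (hA : A.det ≠ 0)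
    (h : A.trace = 0 ∨ ∃ c : F, A = c • 1) : PlaneForm F :=
  ⟨areaBilin A, (areaBilin_nondegenerate_iff A).2 hA,
    h.imp (areaBilin_isSymm_iff A).2 (areaBilin_isAlt_iff A).2⟩

lemma PlaneForm.det_formMatrix (B : PlaneForm F) : (formMatrix B.1).det ≠ 0 :=
  (areaBilin_nondegenerate_iff _).1 (by simpa using B.2.1)

lemma PlaneForm.formMatrix_cases (B : PlaneForm F) :
    (formMatrix B.1).trace = 0 ∨ ∃ c : F, formMatrix B.1 = c • 1 := by
  rw [← areaBilin_isSymm_iff, ← areaBilin_isAlt_iff, areaBilin_formMatrix]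
  exact B.2.2

lemma planeArea_mulVec_left (P : Matrix (Fin 2) (Fin 2) F) (u w : Fin 2 → F) :
    planeArea (P *ᵥ u) w = planeArea u (P.adjugate *ᵥ w) := by
  simp [planeArea, Matrix.adjugate_fin_two, Matrix.mulVec, dotProduct, Fin.sum_univ_two]
  ring

/-- The adjoint of a matrix for the area form is its adjugate, and the adjugate of `g⁻¹` is `g / det
g`. Hence, up to scalars, transport of forms is conjugation of matrices. -/
lemma PlaneForm.formMatrix_transport (g : GL (Fin 2) F) (B : PlaneForm F) :
    formMatrix (B.transport g).1 =
      (g.1.det)⁻¹ • (g.1 * formMatrix B.1 * (g⁻¹).1) := by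
  have hd : g.1.det ≠ 0 := (Matrix.isUnit_iff_isUnit_det _).1 g.isUnit |>.ne_zero
  have hadj : (g⁻¹).1.adjugate = (g.1.det)⁻¹ • g.1 := by
    have h1 : (g⁻¹).1.adjugate * (g⁻¹).1 = (g⁻¹).1.det • 1 := Matrix.adjugate_mul _
    have h2 : (g⁻¹).1 * g.1 = 1 := g.inv_mul
    have h3 : (g⁻¹).1.det = (g.1.det)⁻¹ := by
      have := congrArg Matrix.det h2
      rw [Matrix.det_mul, Matrix.det_one] at this
      exact eq_inv_of_mul_eq_one_left this
    rw [← h3, ← mul_one (g⁻¹).1.adjugate, ← h2, ← mul_assoc, h1, smul_mul_assoc, one_mul]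
  refine areaBilin_injective (LinearMap.ext fun u => LinearMap.ext fun v => ?_)
  rw [areaBilin_formMatrix, PlaneForm.transport_apply, ← areaBilin_formMatrix B.1,
    areaBilin_apply, areaBilin_apply, formMatrix_areaBilin]
  change planeArea ((g⁻¹).1 *ᵥ u) (_ *ᵥ ((g⁻¹).1 *ᵥ v)) = _
  rw [planeArea_mulVec_left, hadj, Matrix.mulVec_mulVec, Matrix.mulVec_mulVec]
  simp only [smul_mul_assoc, mul_assoc]

namespace FormClass

/-- The matrix of a representative of a form class. -/
noncomputable def mat (x : FormClass F) : Matrix (Fin 2) (Fin 2) F :=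
  formMatrix (Quotient.out (s := planeFormSetoid F) x).1

lemma mk_out (x : FormClass F) : mk (Quotient.out (s := planeFormSetoid F) x) = x :=
  Quotient.out_eq (s := planeFormSetoid F) x

lemma mk_eq_mk_iff (B C : PlaneForm F) :
    mk B = mk C ↔ ∃ c : F, c ≠ 0 ∧ formMatrix C.1 = c • formMatrix B.1 := by
  have h : mk B = mk C ↔ ∃ c : Fˣ, C.1 = (c : F) • B.1 :=
    ⟨fun h => Quotient.exact (s := planeFormSetoid F) h,
      fun h => Quotient.sound (s := planeFormSetoid F) h⟩
  rw [h]
  constructor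
  · rintro ⟨c, hc⟩
    exact ⟨c, c.ne_zero, by rw [hc, formMatrix_smul]⟩
  · rintro ⟨c, hc, h⟩
    refine ⟨Units.mk0 c hc, ?_⟩
    have := congrArg areaBilin h
    rwa [areaBilin_smul, areaBilin_formMatrix, areaBilin_formMatrix] at this

lemma mk_eq_iff (B : PlaneForm F) (x : FormClass F) :
    mk B = x ↔ ∃ c : F, c ≠ 0 ∧ x.mat = c • formMatrix B.1 := by
  rw [mat, ← mk_eq_mk_iff, mk_out]

lemma eq_iff (x y : FormClass F) : x = y ↔ ∃ c : F, c ≠ 0 ∧ y.mat = c • x.mat := by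
  conv_lhs => rw [← mk_out x, mk_eq_iff]
  rfl

lemma det_mat_ne_zero (x : FormClass F) : x.mat.det ≠ 0 := PlaneForm.det_formMatrix _

/-- The class of the alternating forms. -/
def IsScalar (x : FormClass F) : Prop := ∃ c : F, x.mat = c • 1

lemma trace_mat {x : FormClass F} (hx : ¬ x.IsScalar) : x.mat.trace = 0 :=
  (PlaneForm.formMatrix_cases _).resolve_right hx

lemma exists_mat (A : Matrix (Fin 2) (Fin 2) F) (hA : A.det ≠ 0)
    (h : A.trace = 0 ∨ ∃ c : F, A = c • 1) :
    ∃ (x : FormClass F) (c : F), c ≠ 0 ∧ x.mat = c • A := by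
  refine ⟨mk (.ofMatrix A hA h), ?_⟩
  obtain ⟨c, hc, h⟩ := (mk_eq_iff (.ofMatrix A hA h) _).1 rfl
  exact ⟨c, hc, h.trans (by rw [PlaneForm.ofMatrix, formMatrix_areaBilin])⟩

lemma smul_eq_iff (g : GL (Fin 2) F) (x y : FormClass F) :
    (Matrix.ProjGenLinGroup.mk g : PGL(2, F)) • x = y ↔
      ∃ c : F, c ≠ 0 ∧ y.mat * g.1 = c • (g.1 * x.mat) := by
  have hd : g.1.det ≠ 0 := (Matrix.isUnit_iff_isUnit_det _).1 g.isUnit |>.ne_zero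
  conv_lhs => rw [← mk_out x, pgl_smul_mk, mk_eq_iff, PlaneForm.formMatrix_transport]
  have h2 : (g⁻¹).1 * g.1 = 1 := g.inv_mul
  have h3 : g.1 * (g⁻¹).1 = 1 := g.mul_inv
  constructor
  · rintro ⟨c, hc, h⟩
    refine ⟨c * (g.1.det)⁻¹, mul_ne_zero hc (inv_ne_zero hd), ?_⟩
    rw [h, smul_smul, smul_mul_assoc, mul_assoc, h2, mul_one]
    rfl
  · rintro ⟨c, hc, h⟩
    refine ⟨c * g.1.det, mul_ne_zero hc hd, ?_⟩
    rw [smul_smul, mul_assoc, mul_inv_cancel₀ hd, mul_one, ← mul_one y.mat, ← h3, ← mul_assoc, h,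
      smul_mul_assoc]
    rfl

instance [Finite F] : Finite (FormClass F) := by
  refine Finite.of_injective (mat (F := F)) fun x y h => ?_
  rw [eq_iff]
  exact ⟨1, one_ne_zero, by rw [h, one_smul]⟩

end FormClass

instance [Finite F] : Finite PGL(2, F) :=
  Finite.of_surjective _ Matrix.ProjGenLinGroup.mk_surjective

end FormMatrix

/-! ### Isotropy groups and isotropic lines -/

section Isotropy

open Matrix

variable {F : Type u} [Field F]

lemma planeArea_eq_zero_iff {v : Fin 2 → F} (hv : v ≠ 0) (w : Fin 2 → F) :
    planeArea v w = 0 ↔ ∃ c : F, w = c • v := by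
  constructor
  · intro h
    rw [planeArea, sub_eq_zero] at h
    by_cases h0 : v 0 = 0
    · have h1 : v 1 ≠ 0 := fun h1 => hv (by ext i; fin_cases i <;> assumption)
      refine ⟨w 1 / v 1, ?_⟩
      ext i
      fin_cases i
      · simp only [Fin.zero_eta, Pi.smul_apply, smul_eq_mul, h0, mul_zero]
        rw [h0, zero_mul] at h
        exact (mul_eq_zero.1 h.symm).resolve_left h1
      · simp [h1]
    · refine ⟨w 0 / v 0, ?_⟩
      ext i
      fin_cases i
      · simp [h0]
      · simp only [Fin.mk_one, Pi.smul_apply, smul_eq_mul]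
        field_simp
        linear_combination h
  · rintro ⟨c, rfl⟩
    simp [planeArea]
    ring

/-- Two independent eigenvectors for the same `c` would force `A = c`. Thus every eigenspace of a
nonscalar matrix is at most a line. -/
lemma planeArea_eq_zero_of_eigenvectors {A : Matrix (Fin 2) (Fin 2) F} {c : F}
    (hA : A ≠ c • 1) {v w : Fin 2 → F} (hv : A *ᵥ v = c • v) (hw : A *ᵥ w = c • w) :
    planeArea v w = 0 := by
  by_contra h
  apply hA
  have e : ∀ i (z : Fin 2 → F), A *ᵥ z = c • z → A i 0 * z 0 + A i 1 * z 1 = c * z i := by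
    intro i z hz
    have := congrFun hz i
    simpa [Matrix.mulVec, dotProduct, Fin.sum_univ_two] using this
  ext i j
  -- Cramer's rule: after multiplication by the nonzero area of `v` and `w`, each entry of `A - c`
  -- is a combination of the eigenvector equations.
  refine mul_right_cancel₀ h ?_
  simp only [planeArea]
  have h00 := e 0 v hv
  have h01 := e 0 w hw
  have h10 := e 1 v hv
  have h11 := e 1 w hw
  fin_cases i <;> fin_cases j <;> simp [-mul_eq_mul_right_iff, -mul_eq_zero]
  · linear_combination w 1 * h00 - v 1 * h01
  · linear_combination v 0 * h01 - w 0 * h00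
  · linear_combination w 1 * h10 - v 1 * h11
  · linear_combination v 0 * h11 - w 0 * h10

lemma Matrix.mul_self_of_trace_eq_zero {A : Matrix (Fin 2) (Fin 2) F} (hA : A.trace = 0) :
    A * A = (-A.det) • 1 := by
  rw [Matrix.trace_fin_two] at hA
  ext i j
  fin_cases i <;> fin_cases j <;> simp [Matrix.mul_apply, Matrix.det_fin_two, Fin.sum_univ_two]
  · linear_combination A 0 0 * hA
  · linear_combination A 0 1 * hA
  · linear_combination A 1 0 * hA
  · linear_combination A 1 1 * hA

namespace FormClass

/-- The form takes the value `ω(v, A v)` at `v`, which vanishes exactly when `A v` is proportional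
to `v`. -/
lemma isIsotropicLine_mk_iff (x : FormClass F) (v : Fin 2 → F) (hv : v ≠ 0) :
    IsIsotropicLine x (Projectivization.mk F v hv) ↔ ∃ c : F, x.mat *ᵥ v = c • v := by
  rw [← planeArea_eq_zero_iff hv, ← areaBilin_apply]
  constructor
  · intro h
    have := h _ (mk_out x) v (by simp)
    rwa [mat, areaBilin_formMatrix]
  · intro h B hB w hw
    rw [Projectivization.submodule_mk, Submodule.mem_span_singleton] at hw
    obtain ⟨a, rfl⟩ := hw
    obtain ⟨c, hc, hx⟩ := (mk_eq_iff _ _).1 hB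
    rw [hx, areaBilin_smul, areaBilin_formMatrix, LinearMap.smul_apply, LinearMap.smul_apply,
      smul_eq_mul] at h
    simp [(mul_eq_zero.1 h).resolve_left hc]

lemma not_isScalar_iff {x : FormClass F} : ¬ x.IsScalar ↔ ∀ c : F, x.mat ≠ c • 1 := not_exists

lemma mat_mul_self {x : FormClass F} (hx : ¬ x.IsScalar) :
    x.mat * x.mat = (-x.mat.det) • 1 :=
  Matrix.mul_self_of_trace_eq_zero (trace_mat hx)

lemma IsScalar.smul_eq {x : FormClass F} (hx : x.IsScalar) (g : PGL(2, F)) : g • x = x := by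
  obtain ⟨g, rfl⟩ := Matrix.ProjGenLinGroup.mk_surjective g
  obtain ⟨c, hc⟩ := hx
  rw [smul_eq_iff]
  exact ⟨1, one_ne_zero, by simp [hc]⟩

lemma IsScalar.eq {x y : FormClass F} (hx : x.IsScalar) (hy : y.IsScalar) : x = y := by
  obtain ⟨c, hc⟩ := hx
  obtain ⟨d, hd⟩ := hy
  have hc0 : c ≠ 0 := by
    rintro rfl
    exact x.det_mat_ne_zero (by simp [hc])
  have hd0 : d ≠ 0 := by
    rintro rfl
    exact y.det_mat_ne_zero (by simp [hd])
  rw [eq_iff]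
  exact ⟨d / c, div_ne_zero hd0 hc0, by rw [hc, hd, smul_smul, div_mul_cancel₀ _ hc0]⟩

/-- `g` commutes with the matrices of the form class. -/
def Comm (g : GL (Fin 2) F) (x : FormClass F) : Prop := x.mat * g.1 = g.1 * x.mat

/-- `g` anticommutes with the matrices of the form class. -/
def Anti (g : GL (Fin 2) F) (x : FormClass F) : Prop := x.mat * g.1 = -(g.1 * x.mat)

/-- Fixing the class means `A g = c g A`. Passing `g` across `A²`, which is a nonzero scalar, gives
`c² = 1`. -/
lemma smul_eq_self_iff {x : FormClass F} (hx : ¬ x.IsScalar) (g : GL (Fin 2) F) :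
    (Matrix.ProjGenLinGroup.mk g : PGL(2, F)) • x = x ↔ Comm g x ∨ Anti g x := by
  rw [smul_eq_iff]
  constructor
  · rintro ⟨c, hc, h⟩
    have h1 : x.mat * (x.mat * g.1) = (c * c) • (g.1 * (x.mat * x.mat)) := by
      rw [h, mul_smul_comm, ← mul_assoc, h, smul_mul_assoc, smul_smul, mul_assoc]
    rw [← mul_assoc, mat_mul_self hx, smul_mul_assoc, one_mul, mul_smul_comm, mul_one, smul_smul,
      ← sub_eq_zero, ← sub_smul] at h1
    have hg : g.1 ≠ 0 := g.ne_zero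
    have h2 : (-x.mat.det) * (1 - c * c) = 0 := by
      rw [← (smul_eq_zero.1 h1).resolve_right hg]
      ring
    have h3 : c * c = 1 :=
      (sub_eq_zero.1 ((mul_eq_zero.1 h2).resolve_left (neg_ne_zero.2 x.det_mat_ne_zero))).symm
    rcases mul_self_eq_one_iff.1 h3 with rfl | rfl
    · exact Or.inl (by simpa [Comm] using h)
    · exact Or.inr (by simpa [Anti] using h)
  · rintro (h | h)
    · exact ⟨1, one_ne_zero, by simpa [Comm] using h⟩
    · exact ⟨-1, neg_ne_zero.2 one_ne_zero, by simpa [Anti] using h⟩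

lemma Comm.not_anti (h2 : (2 : F) ≠ 0) {g : GL (Fin 2) F} {x : FormClass F} (h : Comm g x) :
    ¬ Anti g x := by
  intro h'
  have hd : g.1.det ≠ 0 := (Matrix.isUnit_iff_isUnit_det _).1 g.isUnit |>.ne_zero
  have h3 : (2 : F) • (g.1 * x.mat) = 0 := by
    rw [two_smul, ← add_eq_zero_iff_eq_neg.2 h', h]
  have h4 := congrArg Matrix.det ((smul_eq_zero.1 h3).resolve_left h2)
  rw [Matrix.det_mul, Matrix.det_zero] at h4
  exact mul_ne_zero hd x.det_mat_ne_zero h4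

lemma isSquare_of_isIsotropicLine {x : FormClass F} (hx : ¬ x.IsScalar) {v : Fin 2 → F}
    (hv : v ≠ 0) {c : F} (h : x.mat *ᵥ v = c • v) : -x.mat.det = c * c := by
  have h1 : (x.mat * x.mat) *ᵥ v = (c * c) • v := by
    rw [← Matrix.mulVec_mulVec, h, Matrix.mulVec_smul, h, smul_smul]
  rw [mat_mul_self hx, Matrix.smul_mulVec, Matrix.one_mulVec, ← sub_eq_zero, ← sub_smul] at h1
  exact sub_eq_zero.1 ((smul_eq_zero.1 h1).resolve_right hv)

/-- Since `(A - c)(A + c) = 0`, every nonzero vector in the range of `A + c` is an eigenvector; the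
range is nonzero because `A` is not scalar. -/
lemma exists_eigenvector {x : FormClass F} (hx : ¬ x.IsScalar) {c : F}
    (h : -x.mat.det = c * c) : ∃ v, v ≠ 0 ∧ x.mat *ᵥ v = c • v := by
  obtain ⟨u, hu⟩ : ∃ u, (x.mat + c • 1) *ᵥ u ≠ 0 := by
    by_contra! h0
    have h1 : x.mat + c • 1 = 0 := by
      ext i j
      have := congrFun (h0 (Pi.single j 1)) i
      simpa using this
    refine hx ⟨-c, ?_⟩
    rw [neg_smul]
    exact eq_neg_of_add_eq_zero_left h1
  refine ⟨_, hu, ?_⟩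
  rw [Matrix.mulVec_mulVec, mul_add, mat_mul_self hx, h, mul_smul_comm, mul_one,
    ← Matrix.smul_mulVec, smul_add, smul_smul, add_comm]

end FormClass

variable [Finite F]

lemma isotropySign_eq_one {x : FormClass F} (h : MulAction.stabilizer PGL(2, F) x)
    (hL : ∀ L : ℙ F (Fin 2 → F), IsIsotropicLine x L → (h : PGL(2, F)) • L = L) :
    isotropySign x h = 1 := by
  classical
  let : Fintype (isotropicLines x) := Fintype.ofFinite _
  have : MulAction.toPermHom (MulAction.stabilizer PGL(2, F) x) (isotropicLines x) h = 1 := by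
    ext L
    exact hL L.1 L.2
  change Units.map _ (Equiv.Perm.sign (MulAction.toPermHom
    (MulAction.stabilizer PGL(2, F) x) (isotropicLines x) h)) = 1
  rw [this, map_one, map_one]

lemma isotropySign_eq_neg_one {x : FormClass F} (h : MulAction.stabilizer PGL(2, F) x)
    {L₁ L₂ : ℙ F (Fin 2 → F)} (h₁ : IsIsotropicLine x L₁) (h₂ : IsIsotropicLine x L₂)
    (hne : L₁ ≠ L₂) (hL : ∀ L, IsIsotropicLine x L → L = L₁ ∨ L = L₂)
    (hswap : (h : PGL(2, F)) • L₁ = L₂) : isotropySign x h = -1 := by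
  classical
  let : Fintype (isotropicLines x) := Fintype.ofFinite _
  have hmem : ∀ L, IsIsotropicLine x L → IsIsotropicLine x ((h : PGL(2, F)) • L) :=
    fun L hL => (isotropicLines x).smul_mem h hL
  have hswap' : (h : PGL(2, F)) • L₂ = L₁ := by
    rcases hL _ (hmem _ h₂) with h' | h'
    · exact h'
    · rw [← hswap] at h'
      exact absurd (MulAction.injective _ h').symm (hswap ▸ hne)
  have : MulAction.toPermHom (MulAction.stabilizer PGL(2, F) x) (isotropicLines x) h =
      Equiv.swap (⟨L₁, h₁⟩ : isotropicLines x) ⟨L₂, h₂⟩ := by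
    refine Equiv.ext fun L => ?_
    rcases hL L.1 L.2 with h' | h'
    · have : L = ⟨L₁, h₁⟩ := Subtype.ext h'
      rw [this, Equiv.swap_apply_left]
      exact Subtype.ext hswap
    · have : L = ⟨L₂, h₂⟩ := Subtype.ext h'
      rw [this, Equiv.swap_apply_right]
      exact Subtype.ext hswap'
  change Units.map _ (Equiv.Perm.sign (MulAction.toPermHom
    (MulAction.stabilizer PGL(2, F) x) (isotropicLines x) h)) = -1
  rw [this, Equiv.Perm.sign_swap fun h' => hne (congrArg Subtype.val h')]
  ext
  simp

/-- A commuting `g` preserves each eigenspace of `A`, and these are lines. -/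
lemma FormClass.isotropySign_of_comm {x : FormClass F} (hx : ¬ x.IsScalar) (g : GL (Fin 2) F)
    (hg : (Matrix.ProjGenLinGroup.mk g : PGL(2, F)) ∈ MulAction.stabilizer PGL(2, F) x)
    (hc : Comm g x) : isotropySign x ⟨_, hg⟩ = 1 := by
  refine isotropySign_eq_one _ fun L hL => ?_
  induction L using Projectivization.ind with
  | h v hv =>
    obtain ⟨c, hcv⟩ := (isIsotropicLine_mk_iff x v hv).1 hL
    change Projectivization.mk F (g.1 *ᵥ v) ((smul_ne_zero_iff_ne g).2 hv) = _
    rw [Projectivization.mk_eq_mk_iff']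
    have h1 : x.mat *ᵥ (g.1 *ᵥ v) = c • (g.1 *ᵥ v) := by
      rw [Matrix.mulVec_mulVec, hc, ← Matrix.mulVec_mulVec, hcv, Matrix.mulVec_smul]
    obtain ⟨a, ha⟩ := (planeArea_eq_zero_iff hv _).1
      (planeArea_eq_zero_of_eigenvectors (not_isScalar_iff.1 hx c) hcv h1)
    exact ⟨a, ha.symm⟩

/-- An anticommuting `g` maps the `c`-eigenline to the `-c`-eigenline. If `-det A = c²` these are
the two isotropic lines and they are exchanged; if `-det A` is not a square there are no isotropic
lines and the empty permutation has sign `1`. -/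
lemma FormClass.isotropySign_of_anti [Fintype F] [DecidableEq F] (h2 : (2 : F) ≠ 0)
    {x : FormClass F} (hx : ¬ x.IsScalar)
    (g : GL (Fin 2) F)
    (hg : (Matrix.ProjGenLinGroup.mk g : PGL(2, F)) ∈ MulAction.stabilizer PGL(2, F) x)
    (ha : Anti g x) :
    (isotropySign x ⟨_, hg⟩ : ℂ) = -(quadraticChar F (-x.mat.det) : ℤ) := by
  by_cases hsq : IsSquare (-x.mat.det)
  · rw [(quadraticChar_one_iff_isSquare (neg_ne_zero.2 x.det_mat_ne_zero)).2 hsq]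
    obtain ⟨c, hc⟩ := hsq
    have hc0 : c ≠ 0 := by
      rintro rfl
      exact neg_ne_zero.2 x.det_mat_ne_zero (by simpa using hc)
    obtain ⟨v, hv, hcv⟩ := exists_eigenvector hx hc
    have hgv : g.1 *ᵥ v ≠ 0 := (smul_ne_zero_iff_ne g).2 hv
    have h1 : x.mat *ᵥ (g.1 *ᵥ v) = (-c) • (g.1 *ᵥ v) := by
      rw [Matrix.mulVec_mulVec, ha, Matrix.neg_mulVec, ← Matrix.mulVec_mulVec, hcv,
        Matrix.mulVec_smul, neg_smul]
    have hne : c ≠ -c := fun h => hc0 ((mul_eq_zero.1 (show (2 : F) * c = 0 by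
      linear_combination h)).resolve_left h2)
    rw [isotropySign_eq_neg_one (L₁ := Projectivization.mk F v hv)
      (L₂ := Projectivization.mk F _ hgv) _ ((isIsotropicLine_mk_iff _ _ _).2 ⟨c, hcv⟩)
      ((isIsotropicLine_mk_iff _ _ _).2 ⟨-c, h1⟩)]
    · simp
    · intro h
      obtain ⟨a, ha⟩ := (Projectivization.mk_eq_mk_iff' _ _ _ _ _).1 h
      rw [← ha, Matrix.mulVec_smul, h1, smul_comm, ha, ← sub_eq_zero, ← sub_smul] at hcv
      exact hne (sub_eq_zero.1 ((smul_eq_zero.1 hcv).resolve_right hv)).symm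
    · intro L hL
      induction L using Projectivization.ind with
      | h w hw =>
        obtain ⟨d, hd⟩ := (isIsotropicLine_mk_iff x w hw).1 hL
        rw [Projectivization.mk_eq_mk_iff', Projectivization.mk_eq_mk_iff']
        have hcd : d * d = c * c := (isSquare_of_isIsotropicLine hx hw hd).symm.trans hc
        rcases mul_self_eq_mul_self_iff.1 hcd with rfl | rfl
        · obtain ⟨a, ha⟩ := (planeArea_eq_zero_iff hv _).1
            (planeArea_eq_zero_of_eigenvectors (not_isScalar_iff.1 hx d) hcv hd)
          exact Or.inl ⟨a, ha.symm⟩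
        · obtain ⟨a, ha⟩ := (planeArea_eq_zero_iff hgv _).1
            (planeArea_eq_zero_of_eigenvectors (not_isScalar_iff.1 hx (-c)) h1 hd)
          exact Or.inr ⟨a, ha.symm⟩
    · rfl
  · rw [quadraticChar_neg_one_iff_not_isSquare.2 hsq, isotropySign_eq_one]
    · simp
    · intro L hL
      exfalso
      induction L using Projectivization.ind with
      | h w hw =>
        obtain ⟨d, hd⟩ := (isIsotropicLine_mk_iff x w hw).1 hL
        exact hsq ⟨d, isSquare_of_isIsotropicLine hx hw hd⟩

end Isotropy

/-! ### The sign of a projectivity of the projective line -/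

section LineSign

open Matrix

variable {F : Type u} [Field F]

/-- The homomorphism `a ↦ diag (a, 1)`. -/
noncomputable def diagUnit : Fˣ →* GL (Fin 2) F :=
  (Units.map (Matrix.diagonalRingHom (Fin 2) F).toMonoidHom).comp
    ((MulEquiv.piUnits (M := fun _ : Fin 2 => F)).symm.toMonoidHom.comp
      (MonoidHom.mulSingle (fun _ : Fin 2 => Fˣ) 0))

lemma diagUnit_val (a : Fˣ) : (diagUnit a).1 = !![(a : F), 0; 0, 1] := by
  ext i j
  fin_cases i <;> fin_cases j <;> simp [diagUnit]

lemma det_diagUnit (a : Fˣ) : (diagUnit a).1.det = a := by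
  rw [diagUnit_val]
  simp

/-- The point `[t : 1]` of the projective line, for `t ≠ 0`. -/
def unitPoint (t : Fˣ) : ℙ F (Fin 2 → F) :=
  Projectivization.mk F ![(t : F), 1] fun h => one_ne_zero (congrFun h 1)

lemma unitPoint_injective : Function.Injective (unitPoint (F := F)) := by
  intro s t h
  obtain ⟨c, hc⟩ := (Projectivization.mk_eq_mk_iff' _ _ _ _ _).1 h
  have h0 := congrFun hc 0
  have h1 := congrFun hc 1
  simp at h0 h1
  rw [h1, one_mul] at h0
  exact Units.ext h0.symm

lemma diagUnit_smul_unitPoint (a t : Fˣ) :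
    (Matrix.ProjGenLinGroup.mk (diagUnit a) : PGL(2, F)) • unitPoint t = unitPoint (a * t) := by
  have ht : ![(t : F), 1] ≠ 0 := fun h => one_ne_zero (congrFun h 1)
  change Projectivization.mk F ((diagUnit a).1 *ᵥ ![(t : F), 1])
    ((smul_ne_zero_iff_ne (diagUnit a)).2 ht) = _
  simp only [unitPoint]
  congr 1
  rw [diagUnit_val]
  ext i
  fin_cases i <;> simp [Matrix.mulVec, dotProduct, Fin.sum_univ_two]

/-- The points off the two coordinate axes are the only ones that `diag(a, 1)` can move. -/
lemma exists_unitPoint_of_smul_ne (a : Fˣ) (L : ℙ F (Fin 2 → F))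
    (hL : (Matrix.ProjGenLinGroup.mk (diagUnit a) : PGL(2, F)) • L ≠ L) :
    ∃ t, L = unitPoint t := by
  induction L using Projectivization.ind with
  | h v hv =>
    have key : ∀ c : F, c • v = (diagUnit a).1 *ᵥ v → False := fun c hc => by
      refine hL ?_
      change Projectivization.mk F ((diagUnit a).1 *ᵥ v) ((smul_ne_zero_iff_ne (diagUnit a)).2 hv) = _
      rw [Projectivization.mk_eq_mk_iff']
      exact ⟨c, hc⟩
    rw [diagUnit_val] at key
    have h0 : v 0 ≠ 0 := fun h0 => key 1 (by
      ext i
      fin_cases i <;> simp [Matrix.mulVec, dotProduct, Fin.sum_univ_two, h0])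
    have h1 : v 1 ≠ 0 := fun h1 => key a (by
      ext i
      fin_cases i <;> simp [Matrix.mulVec, dotProduct, Fin.sum_univ_two, h1])
    refine ⟨Units.mk0 (v 0 / v 1) (div_ne_zero h0 h1), ?_⟩
    rw [unitPoint, Projectivization.mk_eq_mk_iff']
    refine ⟨v 1, ?_⟩
    ext i
    fin_cases i <;> simp [mul_div_cancel₀, h1]

variable [Fintype F]

open scoped Classical in
/-- The sign of the permutation of the projective line given by a matrix. -/
noncomputable def lineSign : GL (Fin 2) F →* ℤˣ :=
  letI : Fintype (ℙ F (Fin 2 → F)) := Fintype.ofFinite _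
  (Equiv.Perm.sign.comp (MulAction.toPermHom PGL(2, F) (ℙ F (Fin 2 → F)))).comp
    Matrix.ProjGenLinGroup.mk

lemma lineSign_scalar (c : Fˣ) : lineSign (Matrix.GeneralLinearGroup.scalar (Fin 2) c) = 1 := by
  rw [lineSign, MonoidHom.comp_apply, Matrix.ProjGenLinGroup.mk_scalar, map_one]

variable [DecidableEq F]

lemma quadraticChar_toUnitHom_generator (hF : ringChar F ≠ 2) {a : Fˣ}
    (ha : ∀ b, b ∈ Subgroup.zpowers a) : (quadraticChar F).toUnitHom a = -1 := by
  refine (Int.units_eq_one_or _).resolve_left fun h1 => ?_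
  obtain ⟨b, hb⟩ := quadraticChar_exists_neg_one hF
  have hb0 : b ≠ 0 := by
    rintro rfl
    simp at hb
  obtain ⟨k, hk⟩ := ha (Units.mk0 b hb0)
  have h2 : (quadraticChar F).toUnitHom (Units.mk0 b hb0) = 1 := by
    rw [← hk]
    simp only [map_zpow, h1, _root_.one_zpow]
  have h3 := congrArg Units.val h2
  rw [MulChar.coe_toUnitHom, Units.val_mk0, hb] at h3
  exact absurd h3 (by decide)

/-- For a generator `a` of `Fˣ`, the permutation is a single cycle through the `q - 1` points off
the axes. As `q` is odd, the cycle has even length and is an odd permutation. -/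
lemma lineSign_diagUnit_generator (hF : ringChar F ≠ 2) {a : Fˣ}
    (ha : ∀ b, b ∈ Subgroup.zpowers a) : lineSign (diagUnit a) = -1 := by
  classical
  let : Fintype (ℙ F (Fin 2 → F)) := Fintype.ofFinite _
  have ha1 : a ≠ 1 := by
    rintro rfl
    have := quadraticChar_toUnitHom_generator hF ha
    rw [map_one] at this
    exact absurd this (by decide)
  let f : Equiv.Perm (ℙ F (Fin 2 → F)) := MulAction.toPermHom PGL(2, F) (ℙ F (Fin 2 → F))
    (Matrix.ProjGenLinGroup.mk (diagUnit a))
  have hne : ∀ t, f (unitPoint t) ≠ unitPoint t := fun t ht =>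
    ha1 (mul_eq_right.1 (unitPoint_injective ((diagUnit_smul_unitPoint a t).symm.trans ht)))
  have hcycle : f.IsCycle := by
    refine ⟨unitPoint 1, hne 1, fun y hy => ?_⟩
    obtain ⟨t, rfl⟩ := exists_unitPoint_of_smul_ne a y hy
    obtain ⟨k, rfl⟩ := ha t
    refine ⟨k, ?_⟩
    simp only [f]
    rw [← map_zpow, ← map_zpow, ← map_zpow]
    exact (diagUnit_smul_unitPoint _ _).trans (by rw [mul_one])
  have hsupp : f.support = Finset.univ.map ⟨unitPoint, unitPoint_injective⟩ := by
    ext y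
    rw [Equiv.Perm.mem_support, Finset.mem_map]
    constructor
    · intro hy
      obtain ⟨t, rfl⟩ := exists_unitPoint_of_smul_ne a y hy
      exact ⟨t, Finset.mem_univ _, rfl⟩
    · rintro ⟨t, -, rfl⟩
      exact hne t
  have heven : Even f.support.card := by
    rw [hsupp, Finset.card_map, Finset.card_univ, Fintype.card_units]
    have := FiniteField.odd_card_of_char_ne_two hF
    exact (Nat.Odd.sub_odd (Nat.odd_iff.2 this) odd_one)
  change Equiv.Perm.sign f = -1
  rw [hcycle.sign, heven.neg_one_pow]

lemma lineSign_diagUnit (hF : ringChar F ≠ 2) (a : Fˣ) :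
    lineSign (diagUnit a) = (quadraticChar F).toUnitHom a := by
  obtain ⟨b, hb⟩ := IsCyclic.exists_generator (α := Fˣ)
  obtain ⟨k, rfl⟩ := hb a
  simp only [map_zpow, lineSign_diagUnit_generator hF hb, quadraticChar_toUnitHom_generator hF hb]

/-- The sign of the permutation of the projective line over a finite field of odd order given by
`g` is the quadratic character of `det g`. -/
theorem lineSign_eq (hF : ringChar F ≠ 2) (g : GL (Fin 2) F) :
    lineSign g = (quadraticChar F).toUnitHom (Matrix.GeneralLinearGroup.det g) := by
  have h2 : (2 : F) ≠ 0 := Ring.two_ne_zero hF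
  have hd : g.1.det ≠ 0 := (Matrix.isUnit_iff_isUnit_det _).1 g.isUnit |>.ne_zero
  refine Matrix.diagonal_transvection_induction_of_det_ne_zero
    (fun M => ∀ g : GL (Fin 2) F, g.1 = M →
      lineSign g = (quadraticChar F).toUnitHom (Matrix.GeneralLinearGroup.det g))
    g.1 hd ?_ ?_ ?_ g rfl
  · intro D hD g hg
    rw [Matrix.det_diagonal, Fin.prod_univ_two] at hD
    have hD0 := left_ne_zero_of_mul hD
    have hD1 := right_ne_zero_of_mul hD
    -- Modulo scalars a diagonal matrix is `diag(D₀ / D₁, 1)`; the scalar acts trivially and changes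
    -- the determinant by a square.
    have h : g = Matrix.GeneralLinearGroup.scalar (Fin 2) (Units.mk0 _ hD1) *
        diagUnit (Units.mk0 (D 0 / D 1) (div_ne_zero hD0 hD1)) := by
      refine Units.ext ?_
      rw [hg, Units.val_mul, diagUnit_val]
      ext i j
      fin_cases i <;> fin_cases j <;>
        simp [Matrix.mul_apply, Fin.sum_univ_two, mul_div_cancel₀, hD1]
    have hs : Matrix.GeneralLinearGroup.det (Matrix.GeneralLinearGroup.scalar (Fin 2)
        (Units.mk0 _ hD1)) = (Units.mk0 _ hD1) * (Units.mk0 _ hD1) := by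
      ext
      simp [pow_two]
    have hdd : Matrix.GeneralLinearGroup.det (diagUnit
        (Units.mk0 (D 0 / D 1) (div_ne_zero hD0 hD1))) = Units.mk0 (D 0 / D 1)
          (div_ne_zero hD0 hD1) := Units.ext (det_diagUnit _)
    rw [h, map_mul, map_mul, map_mul, lineSign_scalar, one_mul, lineSign_diagUnit hF, hs, hdd,
      map_mul, Int.units_mul_self, one_mul]
  · intro t g hg
    have hdt : ∀ c : F, (Matrix.transvection t.i t.j c).det ≠ 0 := fun c => by
      rw [Matrix.det_transvection_of_ne _ _ t.hij]
      exact one_ne_zero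
    -- A transvection is the square of the one with half the parameter, so both signs are `1`.
    let s := Matrix.GeneralLinearGroup.mkOfDetNeZero (Matrix.transvection t.i t.j (t.c / 2)) (hdt _)
    have hs : g = s * s := by
      refine Units.ext ?_
      rw [hg, Units.val_mul]
      change Matrix.transvection t.i t.j t.c = Matrix.transvection t.i t.j (t.c / 2) *
        Matrix.transvection t.i t.j (t.c / 2)
      rw [Matrix.transvection_mul_transvection_same _ _ t.hij, ← two_mul, mul_div_cancel₀ _ h2]
    rw [hs, map_mul, map_mul, map_mul, Int.units_mul_self, Int.units_mul_self]
  · intro A B hA hB ihA ihB g hg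
    have hs : g = Matrix.GeneralLinearGroup.mkOfDetNeZero A hA *
        Matrix.GeneralLinearGroup.mkOfDetNeZero B hB := Units.ext hg
    rw [hs, map_mul, map_mul, map_mul, ihA _ rfl, ihB _ rfl]

lemma FormClass.IsScalar.isotropySign_eq (hF : ringChar F ≠ 2) {x : FormClass F}
    (hx : x.IsScalar) :
    isotropySign x = detSign.comp (MulAction.stabilizer PGL(2, F) x).subtype := by
  classical
  let : Fintype (ℙ F (Fin 2 → F)) := Fintype.ofFinite _
  let : Fintype (isotropicLines x) := Fintype.ofFinite _
  have hall : ∀ L, L ∈ isotropicLines x := by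
    intro L
    induction L using Projectivization.ind with
    | h v hv =>
      obtain ⟨c, hc⟩ := hx
      exact (isIsotropicLine_mk_iff x v hv).2 ⟨c, by rw [hc, Matrix.smul_mulVec, Matrix.one_mulVec]⟩
  refine MonoidHom.ext fun ⟨h, hh⟩ => ?_
  obtain ⟨g, rfl⟩ := Matrix.ProjGenLinGroup.mk_surjective h
  have hsign := Equiv.Perm.sign_eq_sign_of_equiv
    (MulAction.toPermHom (MulAction.stabilizer PGL(2, F) x) (isotropicLines x)
      ⟨Matrix.ProjGenLinGroup.mk g, hh⟩)
    (MulAction.toPermHom PGL(2, F) (ℙ F (Fin 2 → F)) (Matrix.ProjGenLinGroup.mk g))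
    (Equiv.subtypeUnivEquiv hall) (fun L => rfl)
  have hline := lineSign_eq hF g
  change Units.map _ (Equiv.Perm.sign _) = Units.map _ ((quadraticChar F).toUnitHom
    (Matrix.GeneralLinearGroup.det g))
  rw [← hline]
  exact congrArg _ hsign

end LineSign

/-! ### Counting fixed form classes and square roots -/

section Counting

open Matrix

variable {F : Type u} [Field F]

lemma Matrix.GeneralLinearGroup.det_val_ne_zero (g : GL (Fin 2) F) : g.1.det ≠ 0 :=
  ((Matrix.isUnit_iff_isUnit_det _).1 g.isUnit).ne_zero

lemma Matrix.ProjGenLinGroup.mk_eq_mk_iff_exists_smul (g h : GL (Fin 2) F) :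
    (Matrix.ProjGenLinGroup.mk g : PGL(2, F)) = Matrix.ProjGenLinGroup.mk h ↔
      ∃ c : F, c ≠ 0 ∧ h.1 = c • g.1 := by
  rw [Matrix.ProjGenLinGroup.mk_eq_mk_iff]
  have key : ∀ c : Fˣ, (g * Matrix.GeneralLinearGroup.scalar (Fin 2) c).1 = (c : F) • g.1 := by
    intro c
    ext i j
    simp [mul_comm]
  constructor
  · rintro ⟨c, rfl⟩
    exact ⟨c, c.ne_zero, key c⟩
  · rintro ⟨c, hc, h'⟩
    exact ⟨Units.mk0 c hc, Units.ext ((key _).trans h'.symm)⟩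

lemma Matrix.mul_self_fin_two (A : Matrix (Fin 2) (Fin 2) F) :
    A * A = A.trace • A - A.det • 1 := by
  ext i j
  fin_cases i <;> fin_cases j <;>
    simp [Matrix.mul_apply, Matrix.det_fin_two, Matrix.trace_fin_two, Fin.sum_univ_two] <;> ring

lemma Matrix.det_smul_one_add_smul (A : Matrix (Fin 2) (Fin 2) F) (a b : F) :
    (a • 1 + b • A).det = a ^ 2 + a * b * A.trace + b ^ 2 * A.det := by
  simp [Matrix.det_fin_two, Matrix.trace_fin_two]
  ring

/-- The centralizer of a nonscalar `M` is `F[M]`. The coefficient `b` is the ratio of the entries of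
`A` and `M` at a nonzero off-diagonal place of `M`, or of the differences of diagonal entries if `M`
is diagonal; the entry `(0, 0)` then determines `a`. -/
lemma Matrix.exists_eq_of_commute_fin_two {A M : Matrix (Fin 2) (Fin 2) F}
    (hM : ∀ c : F, M ≠ c • 1) (h : A * M = M * A) : ∃ a b : F, A = a • 1 + b • M := by
  have e : ∀ i j, (A * M) i j = (M * A) i j := fun i j => by rw [h]
  simp only [Matrix.mul_apply, Fin.sum_univ_two] at e
  have e00 := e 0 0
  have e01 := e 0 1
  have e10 := e 1 0
  by_cases h01 : M 0 1 = 0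
  · by_cases h10 : M 1 0 = 0
    · have hd : M 0 0 - M 1 1 ≠ 0 := fun hd => hM (M 0 0) (by
        ext i j
        fin_cases i <;> fin_cases j <;> simp [h01, h10]
        exact (sub_eq_zero.1 hd).symm)
      have hA01 : A 0 1 = 0 := (mul_eq_zero.1 (show (M 0 0 - M 1 1) * A 0 1 = 0 by
        rw [h01] at e01
        linear_combination -e01)).resolve_left hd
      have hA10 : A 1 0 = 0 := (mul_eq_zero.1 (show (M 0 0 - M 1 1) * A 1 0 = 0 by
        rw [h10] at e10
        linear_combination e10)).resolve_left hd
      refine ⟨A 0 0 - (A 0 0 - A 1 1) / (M 0 0 - M 1 1) * M 0 0,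
        (A 0 0 - A 1 1) / (M 0 0 - M 1 1), ?_⟩
      ext i j
      fin_cases i <;> fin_cases j <;> simp [h01, h10, hA01, hA10]
      field_simp
      ring
    · refine ⟨A 0 0 - A 1 0 / M 1 0 * M 0 0, A 1 0 / M 1 0, ?_⟩
      ext i j
      fin_cases i <;> fin_cases j <;> simp [h10]
      · field_simp
        linear_combination e00
      · field_simp
        linear_combination e10
  · refine ⟨A 0 0 - A 0 1 / M 0 1 * M 0 0, A 0 1 / M 0 1, ?_⟩
    ext i j
    fin_cases i <;> fin_cases j <;> simp [h01]
    · field_simp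
      linear_combination -e00
    · field_simp
      linear_combination -e01

lemma Matrix.trace_mul_eq_zero_of_anti (h2 : (2 : F) ≠ 0) {A M : Matrix (Fin 2) (Fin 2) F}
    (h : A * M = -(M * A)) : (M * A).trace = 0 := by
  have h1 := congrArg Matrix.trace h
  rw [Matrix.trace_neg, Matrix.trace_mul_comm] at h1
  exact (mul_eq_zero.1 (show 2 * (M * A).trace = 0 by linear_combination h1)).resolve_left h2

/-! ### Form classes commuting or anticommuting with a given element -/

namespace FormClass

lemma IsScalar.trace_ne_zero (h2 : (2 : F) ≠ 0) {x : FormClass F} (hx : x.IsScalar) :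
    x.mat.trace ≠ 0 := by
  obtain ⟨c, hc⟩ := hx
  have hd := x.det_mat_ne_zero
  rw [hc, Matrix.det_smul, Matrix.det_one, mul_one] at hd
  have hc0 : c ≠ 0 := by
    rintro rfl
    simp at hd
  rw [hc, Matrix.trace_smul, Matrix.trace_one]
  simpa using ⟨hc0, h2⟩

/-- The trace of `A g A` is `-det A · tr g` by cyclicity and `det A · tr g` by anticommutation. -/
lemma trace_eq_zero_of_anti (h2 : (2 : F) ≠ 0) {g : GL (Fin 2) F} {x : FormClass F}
    (hx : ¬ x.IsScalar) (h : Anti g x) : g.1.trace = 0 := by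
  have h1 : (x.mat * g.1 * x.mat).trace = -x.mat.det * g.1.trace := by
    rw [Matrix.trace_mul_comm, ← mul_assoc, mat_mul_self hx, smul_mul_assoc, one_mul,
      Matrix.trace_smul, smul_eq_mul]
  rw [h, neg_mul, mul_assoc, mat_mul_self hx, mul_smul_comm, mul_one, Matrix.trace_neg,
    Matrix.trace_smul, smul_eq_mul] at h1
  have h3 : 2 * (x.mat.det * g.1.trace) = 0 := by linear_combination h1
  exact (mul_eq_zero.1 ((mul_eq_zero.1 h3).resolve_left h2)).resolve_left x.det_mat_ne_zero

noncomputable instance [Finite F] : Fintype (FormClass F) := Fintype.ofFinite _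

noncomputable instance [Finite F] : Fintype PGL(2, F) := Fintype.ofFinite _

/-- An element `k` of `F[g]` commutes with `g`, so `k A` still anticommutes with `g`; it is
traceless because `A` and `g A` are. So the units of `F[g]` act on the classes anticommuting with
`g`. -/
lemma exists_mul_anti (h2 : (2 : F) ≠ 0) {g : GL (Fin 2) F} {k : Matrix (Fin 2) (Fin 2) F}
    {a b : F} (hk : k = a • 1 + b • g.1) (hd : k.det ≠ 0) {x : FormClass F}
    (hx : ¬ x.IsScalar) (h : Anti g x) :
    ∃ y : FormClass F, (¬ y.IsScalar ∧ Anti g y) ∧ ∃ c : F, c ≠ 0 ∧ y.mat = c • (k * x.mat) := by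
  have htr : (k * x.mat).trace = 0 := by
    rw [hk, add_mul, smul_mul_assoc, smul_mul_assoc, one_mul, Matrix.trace_add, Matrix.trace_smul,
      Matrix.trace_smul, trace_mat hx, Matrix.trace_mul_eq_zero_of_anti h2 h]
    simp
  obtain ⟨y, c, hc, hy⟩ := exists_mat (k * x.mat)
    (by rw [Matrix.det_mul]; exact mul_ne_zero hd x.det_mat_ne_zero) (Or.inl htr)
  refine ⟨y, ⟨fun hs => hs.trace_ne_zero h2 ?_, ?_⟩, c, hc, hy⟩
  · rw [hy, Matrix.trace_smul, htr, smul_zero]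
  · have hkg : k * g.1 = g.1 * k := by
      rw [hk, add_mul, mul_add, smul_mul_assoc, mul_smul_comm, one_mul, mul_one, smul_mul_assoc,
        mul_smul_comm]
    rw [Anti, hy, smul_mul_assoc, mul_assoc, h, mul_smul_comm, mul_neg, ← mul_assoc, hkg,
      mul_assoc, smul_neg]

variable [Fintype F] [DecidableEq F]

/-- For traceless `g` the determinant of `a + b g` is `a² + b² det g`, a nondegenerate binary
quadratic form; over a finite field of odd order it represents every nonsquare. -/
lemma exists_quadraticChar_det_eq_neg_one (hF : ringChar F ≠ 2) (g : GL (Fin 2) F)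
    (hg : g.1.trace = 0) :
    ∃ a b : F, quadraticChar F (a • 1 + b • g.1).det = -1 := by
  obtain ⟨n, hn⟩ := quadraticChar_exists_neg_one hF
  have hd := g.det_val_ne_zero
  have h1 : (Polynomial.C g.1.det * Polynomial.X ^ 2 - Polynomial.C n).degree = 2 := by
    rw [Polynomial.degree_sub_C]
    · exact Polynomial.degree_C_mul_X_pow 2 hd
    · rw [Polynomial.degree_C_mul_X_pow 2 hd]
      exact by decide
  obtain ⟨a, b, hab⟩ := FiniteField.exists_root_sum_quadratic
    (Polynomial.degree_X_pow (R := F) 2) h1 (FiniteField.odd_card_of_char_ne_two hF)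
  refine ⟨a, b, ?_⟩
  simp only [Polynomial.eval_pow, Polynomial.eval_X, Polynomial.eval_sub, Polynomial.eval_mul,
    Polynomial.eval_C] at hab
  rw [Matrix.det_smul_one_add_smul, hg, ← hn]
  congr 1
  linear_combination hab

open scoped Classical in
/-- Among the form classes anticommuting with `g`, as many are split as are not. -/
theorem sum_quadraticChar_anti (hF : ringChar F ≠ 2) (g : GL (Fin 2) F) :
    ∑ x : FormClass F with ¬ x.IsScalar ∧ Anti g x, quadraticChar F (-x.mat.det) = 0 := by
  have h2 : (2 : F) ≠ 0 := Ring.two_ne_zero hF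
  by_cases hg : g.1.trace = 0
  · obtain ⟨a, b, hab⟩ := exists_quadraticChar_det_eq_neg_one hF g hg
    set k := a • 1 + b • g.1 with hk
    have hkd : k.det ≠ 0 := by
      intro h
      rw [h, MulChar.map_zero] at hab
      exact absurd hab (by decide)
    rw [Finset.sum_subtype (p := fun x : FormClass F => ¬ x.IsScalar ∧ Anti g x) _
      (fun x => by simp) (fun x => quadraticChar F (-x.mat.det))]
    choose f hfS c hc hf using fun x : {x : FormClass F // ¬ x.IsScalar ∧ Anti g x} =>
      exists_mul_anti h2 hk hkd x.2.1 x.2.2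
    let φ : {x : FormClass F // ¬ x.IsScalar ∧ Anti g x} →
      {x : FormClass F // ¬ x.IsScalar ∧ Anti g x} := fun x => ⟨f x, hfS x⟩
    have hφ : Function.Injective φ := by
      intro x y hxy
      have h1 : c y • (k * y.1.mat) = c x • (k * x.1.mat) := by
        rw [← hf, ← hf, show f x = f y from congrArg Subtype.val hxy]
      have h3 := congrArg (fun M => k⁻¹ * M) h1
      simp only [mul_smul_comm, ← mul_assoc,
        Matrix.nonsing_inv_mul k (isUnit_iff_ne_zero.2 hkd), one_mul] at h3
      refine Subtype.ext ((eq_iff _ _).2 ⟨c x / c y, div_ne_zero (hc x) (hc y), ?_⟩)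
      rw [div_eq_inv_mul, mul_smul, ← h3, smul_smul, inv_mul_cancel₀ (hc y), one_smul]
    -- The sum is reindexed by the bijection `A ↦ k A`, which changes the sign of every term because
    -- `det k` is not a square.
    have hsum := (Finite.injective_iff_bijective.1 hφ).sum_comp
      fun x => quadraticChar F (-x.1.mat.det)
    have hneg : ∀ x, quadraticChar F (-(φ x).1.mat.det) = -quadraticChar F (-x.1.mat.det) := by
      intro x
      have h1 : -(φ x).1.mat.det = c x ^ 2 * (k.det * -x.1.mat.det) := by
        rw [show (φ x).1 = f x from rfl, hf, Matrix.det_smul, Matrix.det_mul, Fintype.card_fin]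
        ring
      rw [h1, map_mul, map_mul, quadraticChar_sq_one' (hc x), hab]
      ring
    simp only [hneg, Finset.sum_neg_distrib] at hsum
    linarith
  · refine Finset.sum_eq_zero fun x hx => ?_
    rw [Finset.mem_filter] at hx
    exact absurd (trace_eq_zero_of_anti h2 hx.2.1 hx.2.2) hg

-- A matrix commuting with `g` lies in `F[g]`, and its traceless elements are the multiples of the
-- traceless part `g - tr(g) / 2`. This gives one class if that matrix is invertible and none
-- otherwise; its determinant is minus a quarter of the discriminant of `g`.
open scoped Classical in
theorem card_comm (hF : ringChar F ≠ 2) (g : GL (Fin 2) F) (hg : ∀ c : F, g.1 ≠ c • 1) :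
    ({x : FormClass F | ¬ x.IsScalar ∧ Comm g x} : Finset (FormClass F)).card =
      if g.1.trace ^ 2 = 4 * g.1.det then 0 else 1 := by
  have h2 : (2 : F) ≠ 0 := Ring.two_ne_zero hF
  set A := (-(g.1.trace / 2)) • 1 + (1 : F) • g.1 with hA
  have hdet : 4 * A.det = 4 * g.1.det - g.1.trace ^ 2 := by
    rw [hA, Matrix.det_smul_one_add_smul]
    field_simp
    ring
  have htr : A.trace = 0 := by
    rw [hA]
    simp
    field_simp
    ring
  have h4 : (4 : F) ≠ 0 := by
    have := mul_ne_zero h2 h2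
    norm_num at this
    exact this
  have key : ∀ x : FormClass F, ¬ x.IsScalar → Comm g x → ∃ c : F, c ≠ 0 ∧ x.mat = c • A := by
    intro x hx hc
    obtain ⟨a, b, hab⟩ := Matrix.exists_eq_of_commute_fin_two hg hc
    have h0 := trace_mat hx
    rw [hab] at h0
    simp at h0
    have ha : a = b * (-(g.1.trace / 2)) := by
      field_simp
      linear_combination h0
    have hxA : x.mat = b • A := by
      rw [hab, hA, ha, smul_add, smul_smul, one_smul]
    refine ⟨b, ?_, hxA⟩
    rintro rfl
    exact x.det_mat_ne_zero (by simp [hxA])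
  split_ifs with hdisc
  · rw [Finset.card_eq_zero, Finset.filter_eq_empty_iff]
    rintro x - ⟨hx, hc⟩
    obtain ⟨c, -, h⟩ := key x hx hc
    refine x.det_mat_ne_zero ?_
    have hA0 : A.det = 0 := (mul_eq_zero.1 (by rw [hdet, hdisc, sub_self])).resolve_left h4
    rw [h, Matrix.det_smul, hA0, mul_zero]
  · have hA0 : A.det ≠ 0 := fun h => hdisc (by
      rw [h] at hdet
      linear_combination hdet)
    obtain ⟨x₀, c, hc, hx₀⟩ := exists_mat A hA0 (Or.inl htr)
    refine Finset.card_eq_one.2 ⟨x₀, ?_⟩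
    ext x
    simp only [Finset.mem_filter, Finset.mem_univ, true_and, Finset.mem_singleton]
    constructor
    · rintro ⟨hx, hcx⟩
      obtain ⟨d, hd, h⟩ := key x hx hcx
      rw [eq_iff]
      exact ⟨c / d, div_ne_zero hc hd, by rw [hx₀, h, smul_smul, div_mul_cancel₀ _ hd]⟩
    · rintro rfl
      refine ⟨fun hs => hs.trace_ne_zero h2 (by rw [hx₀, Matrix.trace_smul, htr, smul_zero]), ?_⟩
      rw [Comm, hx₀, hA]
      simp [add_mul, mul_add]

end FormClass

/-! ### Square roots in `PGL₂(q)` -/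

variable [Fintype F] [DecidableEq F]

-- There are `χ(d) + 1` square roots of `d`; the condition `2 s + t ≠ 0` removes `s = -t / 2`, which
-- is one of them exactly when `t² = 4 d`.
open scoped Classical in
lemma card_filter_sqrt (hF : ringChar F ≠ 2) (t d : F) :
    ((({s : F | s ^ 2 = d ∧ 2 * s + t ≠ 0} : Finset F).card : ℕ) : ℤ) +
      (if t ^ 2 = 4 * d then 1 else 0) = quadraticChar F d + 1 := by
  have h2 : (2 : F) ≠ 0 := Ring.two_ne_zero hF
  have h4 : (4 : F) ≠ 0 := by
    have := mul_ne_zero h2 h2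
    norm_num at this
    exact this
  have h1 := quadraticChar_card_sqrts hF d
  have h3 := Finset.card_filter_add_card_filter_not (s := ({s : F | s ^ 2 = d} : Finset F))
    (fun s => 2 * s + t ≠ 0)
  rw [Finset.filter_filter, Finset.filter_filter] at h3
  have h5 : ({s : F | s ^ 2 = d ∧ ¬ (2 * s + t ≠ 0)} : Finset F).card =
      if t ^ 2 = 4 * d then 1 else 0 := by
    split_ifs with h
    · refine Finset.card_eq_one.2 ⟨-t / 2, ?_⟩
      ext s
      simp only [Finset.mem_filter, Finset.mem_univ, true_and, Finset.mem_singleton, not_not]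
      constructor
      · rintro ⟨-, hs⟩
        field_simp
        linear_combination hs
      · rintro rfl
        refine ⟨mul_left_cancel₀ h4 ?_, ?_⟩
        · rw [← h]
          field_simp
          ring
        · field_simp
          ring
    · rw [Finset.card_eq_zero, Finset.filter_eq_empty_iff]
      rintro s - ⟨hs, hs'⟩
      rw [not_not] at hs'
      refine h ?_
      rw [← hs]
      linear_combination (t - 2 * s) * hs'
  rw [h5] at h3
  have h6 : ({x : F | x ^ 2 = d} : Set F).toFinset = ({s : F | s ^ 2 = d} : Finset F) := by
    ext
    simp
  rw [h6, ← h3] at h1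
  push_cast at h1
  exact h1

-- By Cayley–Hamilton, `g = c k²` means `c tr(k) k = g + s` with `s = c det k`, and then `s² = det
-- g`. Hence every square root is the class of some `g + s`. Conversely `s² = det g` gives `(g + s)²
-- = (2 s + tr g) g`.
open scoped Classical in
theorem card_sqrt_mk (g : GL (Fin 2) F) (hg : ∀ c : F, g.1 ≠ c • 1) :
    ({h : PGL(2, F) | h ^ 2 = Matrix.ProjGenLinGroup.mk g} : Finset PGL(2, F)).card =
      ({s : F | s ^ 2 = g.1.det ∧ 2 * s + g.1.trace ≠ 0} : Finset F).card := by
  have hgd := g.det_val_ne_zero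
  have hdet : ∀ s : F, s ^ 2 = g.1.det ∧ 2 * s + g.1.trace ≠ 0 → (s • 1 + (1 : F) • g.1).det ≠ 0 := by
    rintro s ⟨hs, hs'⟩
    have hs0 : s ≠ 0 := by
      rintro rfl
      exact hgd (by rw [← hs]; ring)
    -- Here `det(g + s) = s (2 s + tr g)`.
    rw [Matrix.det_smul_one_add_smul, ← hs]
    have := mul_ne_zero hs0 hs'
    intro h
    exact this (by linear_combination h)
  symm
  refine Finset.card_bij (fun s hs => Matrix.ProjGenLinGroup.mk
    (Matrix.GeneralLinearGroup.mkOfDetNeZero _ (hdet s (Finset.mem_filter.1 hs).2))) ?_ ?_ ?_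
  · intro s hs
    have hs' := (Finset.mem_filter.1 hs).2
    rw [Finset.mem_filter]
    refine ⟨Finset.mem_univ _, Eq.symm ?_⟩
    rw [← map_pow, Matrix.ProjGenLinGroup.mk_eq_mk_iff_exists_smul]
    refine ⟨2 * s + g.1.trace, hs'.2, ?_⟩
    rw [pow_two]
    change (s • 1 + (1 : F) • g.1) * (s • 1 + (1 : F) • g.1) = _
    simp only [one_smul, add_mul, mul_add, smul_mul_assoc, mul_smul_comm, one_mul, mul_one,
      Matrix.mul_self_fin_two g.1, ← hs'.1]
    module
  · intro s _ s' _ h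
    obtain ⟨c, hc, h⟩ := (Matrix.ProjGenLinGroup.mk_eq_mk_iff_exists_smul _ _).1 h
    change s' • 1 + (1 : F) • g.1 = c • (s • 1 + (1 : F) • g.1) at h
    -- Otherwise `g` would be scalar.
    have hc1 : 1 - c = 0 := by
      by_contra hne
      refine hg ((c * s - s') / (1 - c)) ?_
      have h3 : (1 - c) • g.1 = (c * s - s') • 1 := by
        rw [sub_smul, sub_smul, sub_eq_sub_iff_add_eq_add, ← sub_eq_zero]
        rw [← sub_eq_zero] at h
        rw [← h]
        module
      rw [div_eq_inv_mul, mul_smul, ← h3, smul_smul, inv_mul_cancel₀ hne, one_smul]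
    obtain rfl : c = 1 := (sub_eq_zero.1 hc1).symm
    have := congrFun (congrFun h 0) 0
    simp at this
    exact this.symm
  · intro h hh
    obtain ⟨k, rfl⟩ := Matrix.ProjGenLinGroup.mk_surjective h
    have hk := (Finset.mem_filter.1 hh).2
    rw [← map_pow, Matrix.ProjGenLinGroup.mk_eq_mk_iff_exists_smul] at hk
    obtain ⟨c, hc, hk⟩ := hk
    have hk' : g.1 = c • (k.1.trace • k.1 - k.1.det • 1) := by
      rw [hk, pow_two, Units.val_mul, Matrix.mul_self_fin_two]
    have ht : k.1.trace ≠ 0 := fun ht => hg (-(c * k.1.det)) (by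
      rw [hk', ht]
      module)
    have hs : (c * k.1.det) ^ 2 = g.1.det := by
      rw [hk, pow_two k, Units.val_mul, Matrix.det_smul, Matrix.det_mul, Fintype.card_fin]
      ring
    have hs' : 2 * (c * k.1.det) + g.1.trace ≠ 0 := by
      have : 2 * (c * k.1.det) + g.1.trace = c * (k.1.trace * k.1.trace) := by
        rw [hk', Matrix.trace_smul, Matrix.trace_sub, Matrix.trace_smul, Matrix.trace_smul,
          Matrix.trace_one]
        simp
        ring
      rw [this]
      exact mul_ne_zero hc (mul_ne_zero ht ht)
    refine ⟨c * k.1.det, Finset.mem_filter.2 ⟨Finset.mem_univ _, hs, hs'⟩, Eq.symm ?_⟩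
    rw [Matrix.ProjGenLinGroup.mk_eq_mk_iff_exists_smul]
    refine ⟨c * k.1.trace, mul_ne_zero hc ht, ?_⟩
    change (c * k.1.det) • 1 + (1 : F) • g.1 = _
    rw [hk']
    module

-- By Cayley–Hamilton, `k²` is scalar exactly when `k` is traceless or scalar, and these are the
-- matrices of the form classes.
open scoped Classical in
theorem card_sqrt_one :
    ({h : PGL(2, F) | h ^ 2 = 1} : Finset PGL(2, F)).card = Fintype.card (FormClass F) := by
  symm
  rw [← Finset.card_univ]
  refine Finset.card_bij (fun x _ => Matrix.ProjGenLinGroup.mk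
    (Matrix.GeneralLinearGroup.mkOfDetNeZero _ x.det_mat_ne_zero)) ?_ ?_ ?_
  · intro x _
    rw [Finset.mem_filter]
    refine ⟨Finset.mem_univ _, Eq.symm ?_⟩
    rw [← map_pow, ← Matrix.ProjGenLinGroup.mk_one,
      Eq.comm, Matrix.ProjGenLinGroup.mk_eq_mk_iff_exists_smul]
    have key : ∃ c : F, x.mat * x.mat = c • 1 := by
      by_cases hx : x.IsScalar
      · obtain ⟨c, hc⟩ := hx
        exact ⟨c * c, by rw [hc, smul_mul_smul_comm, mul_one]⟩
      · exact ⟨_, FormClass.mat_mul_self hx⟩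
    obtain ⟨c, hc⟩ := key
    have hc0 : c ≠ 0 := by
      rintro rfl
      have := congrArg Matrix.det hc
      rw [Matrix.det_mul, zero_smul, Matrix.det_zero] at this
      exact mul_ne_zero x.det_mat_ne_zero x.det_mat_ne_zero this
    refine ⟨c⁻¹, inv_ne_zero hc0, ?_⟩
    rw [pow_two]
    change 1 = c⁻¹ • (x.mat * x.mat)
    rw [hc, smul_smul, inv_mul_cancel₀ hc0, one_smul]
  · intro x _ y _ h
    obtain ⟨c, hc, h⟩ := (Matrix.ProjGenLinGroup.mk_eq_mk_iff_exists_smul _ _).1 h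
    exact (FormClass.eq_iff x y).2 ⟨c, hc, h⟩
  · intro h hh
    obtain ⟨k, rfl⟩ := Matrix.ProjGenLinGroup.mk_surjective h
    have hk := (Finset.mem_filter.1 hh).2
    rw [← map_pow, ← Matrix.ProjGenLinGroup.mk_one,
      Matrix.ProjGenLinGroup.mk_eq_mk_iff_exists_smul] at hk
    obtain ⟨c, hc, hk⟩ := hk
    rw [pow_two, Units.val_mul, Matrix.mul_self_fin_two] at hk
    have hcase : k.1.trace = 0 ∨ ∃ c : F, k.1 = c • 1 := by
      by_cases ht : k.1.trace = 0
      · exact Or.inl ht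
      · refine Or.inr ⟨k.1.trace⁻¹ * (c⁻¹ + k.1.det), ?_⟩
        have h1 : k.1.trace • k.1 = (c⁻¹ + k.1.det) • (1 : Matrix (Fin 2) (Fin 2) F) := by
          have h3 : (c⁻¹ : F) • (1 : Matrix (Fin 2) (Fin 2) F) =
              k.1.trace • k.1 - k.1.det • 1 := by
            have h4 := congrArg (fun M : Matrix (Fin 2) (Fin 2) F => c⁻¹ • M) hk
            simp only [smul_smul, inv_mul_cancel₀ hc, one_smul] at h4
            exact h4
          rw [add_smul, h3, sub_add_cancel]
        rw [mul_smul, ← h1, smul_smul, inv_mul_cancel₀ ht, one_smul]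
    obtain ⟨x, d, hd, hx⟩ := FormClass.exists_mat k.1 k.det_val_ne_zero hcase
    refine ⟨x, Finset.mem_univ _, Eq.symm ?_⟩
    rw [Matrix.ProjGenLinGroup.mk_eq_mk_iff_exists_smul]
    exact ⟨d, hd, hx⟩

end Counting

/-! ### Weights of fixed form classes and orbits -/

section Weights

open Matrix

variable {F : Type u} [Field F]

namespace FormClass

lemma IsScalar.smul {x : FormClass F} (hx : x.IsScalar) (g : PGL(2, F)) : (g • x).IsScalar := by
  rwa [hx.smul_eq]

lemma isScalar_smul_iff (x : FormClass F) (g : PGL(2, F)) : (g • x).IsScalar ↔ x.IsScalar :=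
  ⟨fun h => by simpa using h.smul g⁻¹, fun h => h.smul g⟩

lemma Comm.of_smul {g k : GL (Fin 2) F} {x : FormClass F}
    (h : Comm g ((Matrix.ProjGenLinGroup.mk k : PGL(2, F)) • x)) : Comm (k⁻¹ * g * k) x := by
  obtain ⟨c, hc, hy⟩ := (smul_eq_iff k x _).1 rfl
  set y := (Matrix.ProjGenLinGroup.mk k : PGL(2, F)) • x
  have h1 : k.1 * (k⁻¹).1 = 1 := k.mul_inv
  have h2 : (k⁻¹).1 * k.1 = 1 := k.inv_mul
  have h3 : c • (k.1 * (x.mat * ((k⁻¹).1 * g.1 * k.1))) = c • (g.1 * (k.1 * x.mat)) := by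
    calc c • (k.1 * (x.mat * ((k⁻¹).1 * g.1 * k.1)))
        = (c • (k.1 * x.mat)) * ((k⁻¹).1 * g.1 * k.1) := by
          rw [smul_mul_assoc, mul_assoc k.1]
      _ = y.mat * g.1 * k.1 := by
          rw [← hy, mul_assoc (k⁻¹).1, mul_assoc y.mat, ← mul_assoc k.1, h1, one_mul, mul_assoc]
      _ = c • (g.1 * (k.1 * x.mat)) := by
          rw [h, mul_assoc, hy, mul_smul_comm]
  have h4 := congrArg (fun M => (k⁻¹).1 * (c⁻¹ • M)) h3
  simp only [smul_smul, inv_mul_cancel₀ hc, one_smul, ← mul_assoc, h2, one_mul] at h4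
  change x.mat * ((k⁻¹).1 * g.1 * k.1) = (k⁻¹).1 * g.1 * k.1 * x.mat
  simpa only [mul_assoc] using h4

lemma comm_smul_iff (g k : GL (Fin 2) F) (x : FormClass F) :
    Comm g ((Matrix.ProjGenLinGroup.mk k : PGL(2, F)) • x) ↔ Comm (k⁻¹ * g * k) x := by
  refine ⟨Comm.of_smul, fun h => ?_⟩
  have h1 : Comm (k⁻¹ * g * k) ((Matrix.ProjGenLinGroup.mk k⁻¹ : PGL(2, F)) •
      (Matrix.ProjGenLinGroup.mk k : PGL(2, F)) • x) := by
    rwa [map_inv, inv_smul_smul]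
  have h2 := Comm.of_smul h1
  rwa [show (k⁻¹)⁻¹ * (k⁻¹ * g * k) * k⁻¹ = g by group] at h2

lemma IsScalar.mem_orbit_iff {x : FormClass F} (hx : x.IsScalar) (y : FormClass F) :
    y ∈ MulAction.orbit PGL(2, F) x ↔ y.IsScalar := by
  constructor
  · rintro ⟨k, rfl⟩
    exact hx.smul k
  · intro hy
    rw [hy.eq hx]
    exact MulAction.mem_orbit_self x

variable [Fintype F] [DecidableEq F]

lemma quadraticChar_smul (g : PGL(2, F)) (x : FormClass F) :
    quadraticChar F (-(g • x).mat.det) = quadraticChar F (-x.mat.det) := by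
  obtain ⟨k, rfl⟩ := Matrix.ProjGenLinGroup.mk_surjective g
  obtain ⟨c, hc, hy⟩ := (smul_eq_iff k x _).1 rfl
  have h := congrArg Matrix.det hy
  rw [Matrix.det_mul, Matrix.det_smul, Matrix.det_mul, Fintype.card_fin] at h
  have h1 : -((Matrix.ProjGenLinGroup.mk k : PGL(2, F)) • x).mat.det = c ^ 2 * -x.mat.det := by
    refine mul_right_cancel₀ k.det_val_ne_zero ?_
    linear_combination -h
  rw [h1, map_mul, quadraticChar_sq_one' hc, one_mul]

open scoped Classical in
/-- The contribution of a form class fixed by `g` to the characters of the models; for `δ = -1`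
it is the value at `g` of the sign character of the isotropy group. -/
noncomputable def weight (δ : ℤ) (g : GL (Fin 2) F) (x : FormClass F) : ℤ :=
  if x.IsScalar then quadraticChar F g.1.det
  else if Comm g x then 1 else δ * quadraticChar F (-x.mat.det)

open scoped Classical in
lemma weight_smul (δ : ℤ) (g k : GL (Fin 2) F) (x : FormClass F) :
    weight δ g ((Matrix.ProjGenLinGroup.mk k : PGL(2, F)) • x) = weight δ (k⁻¹ * g * k) x := by
  have hdet : (k⁻¹ * g * k).1.det = g.1.det := by
    have := congrArg Matrix.det (show (k⁻¹).1 * k.1 = 1 from k.inv_mul)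
    rw [Matrix.det_mul, Matrix.det_one] at this
    rw [Units.val_mul, Units.val_mul, Matrix.det_mul, Matrix.det_mul]
    linear_combination g.1.det * this
  exact if_congr (isScalar_smul_iff _ _) (by rw [hdet])
    (if_congr (comm_smul_iff _ _ _) rfl (by rw [quadraticChar_smul]))

lemma isotropySign_eq_weight (hF : ringChar F ≠ 2) (x : FormClass F) (g : GL (Fin 2) F)
    (hg : (Matrix.ProjGenLinGroup.mk g : PGL(2, F)) ∈ MulAction.stabilizer PGL(2, F) x) :
    (isotropySign x ⟨_, hg⟩ : ℂ) = weight (-1) g x := by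
  rw [weight]
  split_ifs with hx hc
  · rw [hx.isotropySign_eq hF]
    rfl
  · rw [isotropySign_of_comm hx g hg hc]
    simp
  · rw [isotropySign_of_anti (Ring.two_ne_zero hF) hx g hg
      (((smul_eq_self_iff hx g).1 hg).resolve_left hc)]
    simp

-- There is exactly one alternating class, and the anticommuting classes cancel. The right-hand side
-- does not involve `δ`: this is why the two models have the same character.
open scoped Classical in
lemma sum_weight (hF : ringChar F ≠ 2) (δ : ℤ) (g : GL (Fin 2) F) :
    ∑ x : FormClass F with (Matrix.ProjGenLinGroup.mk g : PGL(2, F)) • x = x, weight δ g x =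
      quadraticChar F g.1.det +
        ({x : FormClass F | ¬ x.IsScalar ∧ Comm g x} : Finset (FormClass F)).card := by
  have h2 : (2 : F) ≠ 0 := Ring.two_ne_zero hF
  obtain ⟨x₀, c, -, hx₀⟩ := exists_mat (1 : Matrix (Fin 2) (Fin 2) F) (by simp)
    (Or.inr ⟨1, (one_smul _ _).symm⟩)
  have hs : x₀.IsScalar := ⟨c, hx₀⟩
  have hanti := congrArg (δ * ·) (sum_quadraticChar_anti hF g)
  simp only [mul_zero, Finset.mul_sum] at hanti
  have hscalar : quadraticChar F g.1.det =
      ∑ x : FormClass F with x.IsScalar, quadraticChar F g.1.det := by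
    rw [Finset.sum_const, Finset.card_eq_one.2 ⟨x₀, ?_⟩, one_smul]
    ext x
    simp only [Finset.mem_filter, Finset.mem_univ, true_and, Finset.mem_singleton]
    exact ⟨fun h => h.eq hs, fun h => h ▸ hs⟩
  rw [← add_zero (_ + _), ← hanti, Finset.card_filter, Nat.cast_sum, hscalar, Finset.sum_filter,
    Finset.sum_filter, Finset.sum_filter, ← Finset.sum_add_distrib, ← Finset.sum_add_distrib]
  refine Finset.sum_congr rfl fun x _ => ?_
  by_cases hx : x.IsScalar
  · simp [weight, hx, hx.smul_eq]
  · by_cases hc : Comm g x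
    · simp [weight, hx, hc, smul_eq_self_iff hx, hc.not_anti h2]
    · simp [weight, hx, hc, smul_eq_self_iff hx]

open scoped Classical in
/-- The weights of the form classes fixed by `g` add up to the number of square roots of the class
of `g`. -/
theorem sum_weight_eq_card_sqrt (hF : ringChar F ≠ 2) (δ : ℤ) (g : GL (Fin 2) F) :
    ∑ x : FormClass F with (Matrix.ProjGenLinGroup.mk g : PGL(2, F)) • x = x, weight δ g x =
      ({h : PGL(2, F) | h ^ 2 = Matrix.ProjGenLinGroup.mk g} : Finset PGL(2, F)).card := by
  by_cases hg : ∀ c : F, g.1 ≠ c • 1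
  · have h := card_filter_sqrt hF g.1.trace g.1.det
    rw [sum_weight hF, card_comm hF g hg, card_sqrt_mk g hg]
    split_ifs at h ⊢ <;> push_cast <;> linarith
  · push Not at hg
    obtain ⟨c, hc⟩ := hg
    have hc0 : c ≠ 0 := by
      rintro rfl
      exact g.det_val_ne_zero (by simp [hc])
    have h1 : (Matrix.ProjGenLinGroup.mk g : PGL(2, F)) = 1 := by
      rw [← Matrix.ProjGenLinGroup.mk_one, Eq.comm,
        Matrix.ProjGenLinGroup.mk_eq_mk_iff_exists_smul]
      exact ⟨c, hc0, hc⟩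
    -- A scalar `g` is the identity of `PGL₂`: it fixes every class with weight `1`, and the square
    -- roots of `1` are as many as the classes.
    have hw : ∀ x, weight δ g x = 1 := by
      intro x
      have hcomm : Comm g x := by simp [Comm, hc]
      have hq : quadraticChar F g.1.det = 1 := by
        rw [hc, Matrix.det_smul, Matrix.det_one, Fintype.card_fin, mul_one,
          quadraticChar_sq_one' hc0]
      simp [weight, hcomm, hq]
    simp only [h1, card_sqrt_one, hw, one_smul, Finset.sum_const, Finset.filter_true,
      Finset.card_univ, mul_one, nsmul_eq_mul]

lemma exists_cyclic {x : FormClass F} (hx : ¬ x.IsScalar) :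
    ∃ v, planeArea v (x.mat *ᵥ v) ≠ 0 := by
  by_contra! h
  exact hx ((areaBilin_isAlt_iff _).1 h)

/-- Two symmetric form classes are in the same orbit if their discriminants differ by a square. -/
theorem exists_smul_eq {x y : FormClass F} (hx : ¬ x.IsScalar) (hy : ¬ y.IsScalar)
    (h : quadraticChar F (-x.mat.det) = quadraticChar F (-y.mat.det)) :
    ∃ k : PGL(2, F), k • x = y := by
  have hdx := neg_ne_zero.2 x.det_mat_ne_zero
  have hdy := neg_ne_zero.2 y.det_mat_ne_zero
  obtain ⟨r, hr⟩ : IsSquare (-x.mat.det * -y.mat.det) := by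
    rw [← quadraticChar_one_iff_isSquare (mul_ne_zero hdx hdy), map_mul, h, ← pow_two,
      quadraticChar_sq_one hdy]
  have hr0 : r ≠ 0 := by
    rintro rfl
    rw [mul_zero] at hr
    exact mul_ne_zero hdx hdy hr
  obtain ⟨v, hv⟩ := exists_cyclic hx
  obtain ⟨w, hw⟩ := exists_cyclic hy
  have hmv : ∀ (M : Matrix (Fin 2) (Fin 2) F) (z z' : Fin 2 → F), M *ᵥ z = z' → ∀ i,
      M i 0 * z 0 + M i 1 * z 1 = z' i := by
    rintro M z z' rfl i
    simp [Matrix.mulVec, dotProduct, Fin.sum_univ_two]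
  set A := x.mat with hA
  set B := y.mat with hB
  set D := -A.det with hD
  obtain ⟨a, ha⟩ : ∃ a, A *ᵥ v = a := ⟨_, rfl⟩
  obtain ⟨b, hb⟩ : ∃ b, B *ᵥ w = b := ⟨_, rfl⟩
  have hAa : A *ᵥ a = D • v := by
    rw [← ha, Matrix.mulVec_mulVec, mat_mul_self hx, Matrix.smul_mulVec, Matrix.one_mulVec]
  have hBb : B *ᵥ b = (-B.det) • w := by
    rw [← hb, Matrix.mulVec_mulVec, mat_mul_self hy, Matrix.smul_mulVec, Matrix.one_mulVec]
  rw [ha] at hv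
  rw [hb] at hw
  have hAv' := hmv _ _ _ ha
  have hAa' := hmv _ _ _ hAa
  have hBw' := hmv _ _ _ hb
  have hBb' := hmv _ _ _ hBb
  simp only [Pi.smul_apply, smul_eq_mul] at hAa' hBb'
  obtain ⟨c, hc0, hcD⟩ : ∃ c : F, c ≠ 0 ∧ -B.det = c * c * D :=
    ⟨r / D, div_ne_zero hr0 hdx, by field_simp; linear_combination hr⟩
  -- In the basis `(v, A v)` the matrix `A` becomes the companion matrix `C` of `X² - D`; in the
  -- basis `(w, c⁻¹ B w)` the matrix `B` becomes `c C`. The change of basis conjugates one to a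
  -- multiple of the other.
  let P : Matrix (Fin 2) (Fin 2) F := !![v 0, a 0; v 1, a 1]
  let Q : Matrix (Fin 2) (Fin 2) F := !![w 0, c⁻¹ * b 0; w 1, c⁻¹ * b 1]
  let C : Matrix (Fin 2) (Fin 2) F := !![0, D; 1, 0]
  have hP : P.det ≠ 0 := by
    have : P.det = planeArea v a := by
      rw [Matrix.det_fin_two_of, planeArea]
      ring
    rwa [this]
  have hQ : Q.det ≠ 0 := by
    have : Q.det = c⁻¹ * planeArea w b := by
      rw [Matrix.det_fin_two_of, planeArea]
      ring
    rw [this]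
    exact mul_ne_zero (inv_ne_zero hc0) hw
  have hAP : A * P = P * C := by
    ext i j
    fin_cases j
    · have := hAv' i
      fin_cases i <;> simpa [P, C, Matrix.mul_apply, Fin.sum_univ_two] using this
    · have := hAa' i
      fin_cases i <;> simpa [P, C, Matrix.mul_apply, Fin.sum_univ_two, mul_comm D] using this
  have hBQ : B * Q = c • (Q * C) := by
    have h2 : ∀ i, B i 0 * (c⁻¹ * b 0) + B i 1 * (c⁻¹ * b 1) = c * (w i * D) := fun i => by
      have := hBb' i
      rw [hcD] at this
      field_simp
      linear_combination this
    ext i j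
    fin_cases j
    · have := hBw' i
      fin_cases i <;> simpa [Q, C, Matrix.mul_apply, Fin.sum_univ_two, hc0] using this
    · have := h2 i
      fin_cases i <;> simpa [Q, C, Matrix.mul_apply, Fin.sum_univ_two] using this
  let p := Matrix.GeneralLinearGroup.mkOfDetNeZero P hP
  let q := Matrix.GeneralLinearGroup.mkOfDetNeZero Q hQ
  refine ⟨Matrix.ProjGenLinGroup.mk (q * p⁻¹), (smul_eq_iff _ _ _).2 ⟨c, hc0, ?_⟩⟩
  have hp1 : P * (p⁻¹).1 = 1 := p.mul_inv
  have hp2 : (p⁻¹).1 * P = 1 := p.inv_mul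
  change B * (Q * (p⁻¹).1) = c • (Q * (p⁻¹).1 * A)
  have : Q * (p⁻¹).1 * A = Q * C * (p⁻¹).1 := by
    have h3 : (p⁻¹).1 * A = C * (p⁻¹).1 := by
      rw [← mul_one ((p⁻¹).1 * A), ← hp1, ← mul_assoc, mul_assoc (p⁻¹).1, hAP, ← mul_assoc, hp2,
        one_mul]
    rw [mul_assoc, h3, mul_assoc]
  rw [this, ← mul_assoc, hBQ, smul_mul_assoc]

lemma mem_orbit_iff {x : FormClass F} (hx : ¬ x.IsScalar) (y : FormClass F) :
    y ∈ MulAction.orbit PGL(2, F) x ↔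
      ¬ y.IsScalar ∧ quadraticChar F (-y.mat.det) = quadraticChar F (-x.mat.det) := by
  constructor
  · rintro ⟨k, rfl⟩
    exact ⟨fun h => hx ((isScalar_smul_iff _ _).1 h), quadraticChar_smul _ _⟩
  · rintro ⟨hy, h⟩
    exact exists_smul_eq hx hy h.symm

end FormClass

/-- On traceless matrices the determinant is a nondegenerate ternary quadratic form, so it cannot
vanish on the orthogonal complement of `A` for the trace form, whose dimension is at least two. Such
a `k` inverts or anticommutes with suitable matrices by conjugation. -/
lemma exists_traceless_orthogonal (h2 : (2 : F) ≠ 0) {A : Matrix (Fin 2) (Fin 2) F}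
    (hA : A.trace = 0) :
    ∃ k : Matrix (Fin 2) (Fin 2) F, k.trace = 0 ∧ k.det ≠ 0 ∧ (k * A).trace = 0 := by
  have hA' : A 1 1 = -A 0 0 := by
    rw [Matrix.trace_fin_two] at hA
    linear_combination hA
  suffices h : ∃ p q r : F, p ^ 2 + q * r ≠ 0 ∧ 2 * A 0 0 * p + A 0 1 * r + A 1 0 * q = 0 by
    obtain ⟨p, q, r, hd, ht⟩ := h
    refine ⟨!![p, q; r, -p], by simp [Matrix.trace_fin_two], ?_, ?_⟩
    · rw [Matrix.det_fin_two_of]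
      intro h
      exact hd (by linear_combination -h)
    · rw [Matrix.trace_fin_two, Matrix.mul_apply, Matrix.mul_apply, Fin.sum_univ_two,
        Fin.sum_univ_two]
      simp [hA']
      linear_combination ht
  by_cases hb : A 0 1 = 0
  · by_cases ha : A 0 0 = 0
    · exact ⟨1, 0, 0, by simp, by simp [ha]⟩
    · refine ⟨-A 1 0, 2 * A 0 0, (1 - A 1 0 ^ 2) / (2 * A 0 0), ?_, by rw [hb]; ring⟩
      rw [mul_div_cancel₀ _ (mul_ne_zero h2 ha)]
      simp
  · by_cases hc : A 1 0 = 0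
    · by_cases ha : A 0 0 = 0
      · exact ⟨1, 0, 0, by simp, by simp [ha]⟩
      · refine ⟨-A 0 1, (1 - A 0 1 ^ 2) / (2 * A 0 0), 2 * A 0 0, ?_, by rw [hc]; ring⟩
        rw [div_mul_cancel₀ _ (mul_ne_zero h2 ha)]
        simp
    · refine ⟨0, A 0 1, -A 1 0, ?_, by ring⟩
      simpa using ⟨hb, hc⟩

lemma Matrix.ProjGenLinGroup.mk_mul_self_of_trace_eq_zero {g : GL (Fin 2) F}
    (hg : g.1.trace = 0) :
    (Matrix.ProjGenLinGroup.mk g * Matrix.ProjGenLinGroup.mk g : PGL(2, F)) = 1 := by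
  rw [← map_mul, ← Matrix.ProjGenLinGroup.mk_one, Eq.comm,
    Matrix.ProjGenLinGroup.mk_eq_mk_iff_exists_smul]
  exact ⟨_, neg_ne_zero.2 g.det_val_ne_zero, Matrix.mul_self_of_trace_eq_zero hg⟩

/-- Every element of `PGL₂` over a field of odd characteristic is conjugate to its inverse. -/
theorem Matrix.ProjGenLinGroup.isConj_inv (h2 : (2 : F) ≠ 0) (γ : PGL(2, F)) :
    IsConj γ γ⁻¹ := by
  obtain ⟨g, rfl⟩ := Matrix.ProjGenLinGroup.mk_surjective γ
  have htr : (g.1 - (g.1.trace / 2) • 1).trace = 0 := by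
    simp
    field_simp
    ring
  obtain ⟨k, hk, hkd, hkA⟩ := exists_traceless_orthogonal h2 htr
  have hkg : (k * g.1).trace = 0 := by
    rw [mul_sub, Matrix.trace_sub, mul_smul_comm, mul_one, Matrix.trace_smul, hk, smul_zero,
      sub_zero] at hkA
    exact hkA
  let κ := Matrix.GeneralLinearGroup.mkOfDetNeZero k hkd
  -- Both `κ` and `κ g` are traceless, hence of square one in `PGL₂`; from `κ² = 1` and `(κ g)² = 1`
  -- it follows that `κ` conjugates `g` to its inverse.
  have h1 := mk_mul_self_of_trace_eq_zero (g := κ) hk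
  have h3 := mk_mul_self_of_trace_eq_zero (g := κ * g) hkg
  rw [map_mul, ← mul_assoc] at h3
  refine isConj_iff.2 ⟨Matrix.ProjGenLinGroup.mk κ, ?_⟩
  rw [← eq_inv_of_mul_eq_one_left h1]
  exact eq_inv_of_mul_eq_one_left h3

end Weights

/-! ### The three classes of forms -/

section Classes

open Matrix

variable {F : Type u} [Field F]

namespace FormClass

lemma form_self_eq_zero_iff {B : PlaneForm F} {x : FormClass F} (h : mk B = x) (v : Fin 2 → F) :
    B.1 v v = 0 ↔ planeArea v (x.mat *ᵥ v) = 0 := by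
  obtain ⟨c, hc, hx⟩ := (mk_eq_iff _ _).1 h
  rw [← areaBilin_apply, hx, areaBilin_smul, areaBilin_formMatrix, LinearMap.smul_apply,
    LinearMap.smul_apply, smul_eq_mul, mul_eq_zero, or_iff_right hc]

lemma isAlt_iff {B : PlaneForm F} {x : FormClass F} (h : mk B = x) : B.1.IsAlt ↔ x.IsScalar := by
  rw [IsScalar, ← areaBilin_isAlt_iff]
  exact forall_congr' fun v => form_self_eq_zero_iff h v

end FormClass

lemma IsAlternatingClass.isScalar {x : FormClass F} (h : IsAlternatingClass x) : x.IsScalar := by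
  obtain ⟨B, hB, halt⟩ := h
  exact (FormClass.isAlt_iff hB).1 halt

lemma IsSplitClass.not_isScalar {e : (Fin 2 → F) ≃ₗ[F] F × F} {x : FormClass F}
    (h : IsSplitClass e x) : ¬ x.IsScalar := by
  obtain ⟨B, hB, hv⟩ := h
  intro hx
  have h1 := (FormClass.isAlt_iff hB).2 hx (e.symm (1, 1))
  rw [hv] at h1
  simp at h1

/-- The vector with coordinates `(1, 0)` is isotropic, hence an eigenvector, and the square of its
eigenvalue is `-det A`. -/
lemma IsSplitClass.exists_isSquare {e : (Fin 2 → F) ≃ₗ[F] F × F} {x : FormClass F}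
    (h : IsSplitClass e x) : ∃ c : F, -x.mat.det = c * c := by
  have hx := h.not_isScalar
  obtain ⟨B, hB, hv⟩ := h
  have hne : e.symm (1, 0) ≠ 0 := by simp
  obtain ⟨c, hc⟩ := (planeArea_eq_zero_iff hne _).1 ((FormClass.form_self_eq_zero_iff hB _).1
    (by rw [hv]; simp))
  exact ⟨c, FormClass.isSquare_of_isIsotropicLine hx hne hc⟩

lemma IsSplitClass.isotropySign_eq_one_of_memTorus [Finite F] {e : (Fin 2 → F) ≃ₗ[F] F × F}
    {x : FormClass F} (hx : IsSplitClass e x) (h : MulAction.stabilizer PGL(2, F) x)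
    (ht : MemTorus e h) : isotropySign x h = 1 := by
  obtain ⟨g, a, hg, ha⟩ := ht
  obtain ⟨B, hB, hv⟩ := hx
  refine isotropySign_eq_one h fun L hL => ?_
  induction L using Projectivization.ind with
  | h v hv0 =>
    have h0 := hL B hB v (by simp)
    rw [hv] at h0
    rw [← hg]
    change Projectivization.mk F (g • v) ((smul_ne_zero_iff_ne g).2 hv0) = _
    rw [Projectivization.mk_eq_mk_iff']
    rcases mul_eq_zero.1 h0 with h1 | h1
    · exact ⟨a.1.2, e.injective (by rw [ha, map_smul]; ext <;> simp [h1])⟩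
    · exact ⟨a.1.1, e.injective (by rw [ha, map_smul]; ext <;> simp [h1])⟩

/-! ### The norm form and the non-split torus -/

section Norm

variable {E : Type v} [Field E] [Algebra F E]

lemma norm_eq_zero_iff_of_linearEquiv (e : (Fin 2 → F) ≃ₗ[F] E) (z : E) :
    Algebra.norm F z = 0 ↔ z = 0 :=
  Algebra.norm_eq_zero_iff_of_basis (Module.Basis.ofEquivFun e.symm)

lemma IsNormClass.planeArea_ne_zero {e : (Fin 2 → F) ≃ₗ[F] E} {x : FormClass F}
    (h : IsNormClass e x) {v : Fin 2 → F} (hv : v ≠ 0) : planeArea v (x.mat *ᵥ v) ≠ 0 := by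
  obtain ⟨B, hB, hN⟩ := h
  rwa [Ne, ← FormClass.form_self_eq_zero_iff hB, hN, norm_eq_zero_iff_of_linearEquiv e,
    LinearEquiv.map_eq_zero_iff]

lemma IsNormClass.not_isScalar {e : (Fin 2 → F) ≃ₗ[F] E} {x : FormClass F}
    (h : IsNormClass e x) : ¬ x.IsScalar := by
  rintro ⟨c, hc⟩
  have hv : (Pi.single 0 1 : Fin 2 → F) ≠ 0 := by simp
  refine h.planeArea_ne_zero hv ((planeArea_eq_zero_iff hv _).2 ⟨c, ?_⟩)
  rw [hc, Matrix.smul_mulVec, Matrix.one_mulVec]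

/-- A square would give an eigenvector, that is, an isotropic vector of the anisotropic norm form.
-/
lemma IsNormClass.not_isSquare {e : (Fin 2 → F) ≃ₗ[F] E} {x : FormClass F}
    (h : IsNormClass e x) : ¬ IsSquare (-x.mat.det) := by
  rintro ⟨c, hc⟩
  obtain ⟨v, hv, hcv⟩ := FormClass.exists_eigenvector h.not_isScalar hc
  exact h.planeArea_ne_zero hv ((planeArea_eq_zero_iff hv _).2 ⟨c, hcv⟩)

/-- The matrices commuting with the norm form class form the non-split torus. -/
theorem IsNormClass.memTorus_of_comm (h2 : (2 : F) ≠ 0) {e : (Fin 2 → F) ≃ₗ[F] E}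
    {x : FormClass F} (h : IsNormClass e x) {g : GL (Fin 2) F} (hg : FormClass.Comm g x) :
    MemTorus e (Matrix.ProjGenLinGroup.mk g) := by
  have hx := h.not_isScalar
  have hv₀ : e.symm 1 ≠ 0 := by simp
  set v₀ := e.symm 1 with hv₀_def
  -- If `g` is a multiplication, it must be by the image `b` of `1`; `M` is the matrix of this
  -- multiplication.
  set b := e (g • v₀) with hb
  have hb0 : b ≠ 0 := by
    rw [hb, Ne, LinearEquiv.map_eq_zero_iff]
    exact (smul_ne_zero_iff_ne g).2 hv₀
  set A := x.mat with hA
  let M := Algebra.leftMulMatrix (Module.Basis.ofEquivFun e.symm) b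
  have hM : ∀ v, M *ᵥ v = e.symm (b * e v) := by
    intro v
    have := Algebra.leftMulMatrix_mulVec_repr (Module.Basis.ofEquivFun e.symm) b (e v)
    have hr : ∀ z, ⇑((Module.Basis.ofEquivFun e.symm).repr z) = e.symm z := fun z => rfl
    rwa [hr, hr, e.symm_apply_apply] at this
  have hMdet : M.det = Algebra.norm F b := (Algebra.norm_eq_matrix_det _ _).symm
  have hMd : M.det ≠ 0 := by rwa [hMdet, Ne, norm_eq_zero_iff_of_linearEquiv e]
  -- Multiplicativity of the norm: `M` multiplies the quadratic form by `N(b) = det M`.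
  have hq : ∀ v, planeArea (M *ᵥ v) (A *ᵥ (M *ᵥ v)) = M.det * planeArea v (A *ᵥ v) := by
    obtain ⟨B, hB, hN⟩ := h
    obtain ⟨c, hc, hAB⟩ := (FormClass.mk_eq_iff _ _).1 hB
    have hqN : ∀ v, planeArea v (A *ᵥ v) = c * Algebra.norm F (e v) := by
      intro v
      rw [← areaBilin_apply, hA, hAB, areaBilin_smul, areaBilin_formMatrix, LinearMap.smul_apply,
        LinearMap.smul_apply, smul_eq_mul, hN]
    intro v
    rw [hqN, hqN, hM, LinearEquiv.apply_symm_apply, map_mul, hMdet]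
    ring
  have hMA : A * M = M * A := by
    -- By `hq` this matrix defines an alternating form, so it is a scalar `c`; its trace vanishes,
    -- hence `c = 0`, and cancelling the adjugate gives `A M = M A`.
    obtain ⟨c, hc⟩ := (areaBilin_isAlt_iff (M.adjugate * A * M - M.det • A)).1 fun v => by
      have : planeArea v ((M.adjugate * A * M) *ᵥ v) = planeArea (M *ᵥ v) (A *ᵥ (M *ᵥ v)) := by
        rw [planeArea_mulVec_left, Matrix.mulVec_mulVec, Matrix.mulVec_mulVec]
      rw [areaBilin_apply, Matrix.sub_mulVec, Matrix.smul_mulVec]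
      rw [hq] at this
      simp only [planeArea, Pi.sub_apply, Pi.smul_apply, smul_eq_mul] at this ⊢
      linear_combination this
    have htr := congrArg Matrix.trace hc
    rw [Matrix.trace_sub, Matrix.trace_mul_comm, ← mul_assoc, Matrix.mul_adjugate, smul_mul_assoc,
      one_mul, sub_self, Matrix.trace_smul, Matrix.trace_one, Fintype.card_fin, smul_eq_mul] at htr
    have hc0 : c = 0 := (mul_eq_zero.1 htr.symm).resolve_right (by exact_mod_cast h2)
    rw [hc0, zero_smul, sub_eq_zero] at hc
    have h3 := congrArg (fun N => M.det⁻¹ • (M * N)) hc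
    simp only [← mul_assoc, Matrix.mul_adjugate, smul_mul_assoc, one_mul, mul_smul_comm, smul_smul,
      inv_mul_cancel₀ hMd, one_smul] at h3
    exact h3
  -- The matrices `M` and `g` agree at `v₀`, and at `A v₀` because both commute with `A`. These
  -- vectors are independent since `v₀` is not isotropic.
  have hMg : M - g.1 = (0 : F) • 1 := by
    by_contra hne
    have h0 : M *ᵥ v₀ = g.1 *ᵥ v₀ := by
      rw [hM, hv₀_def, LinearEquiv.apply_symm_apply, mul_one, hb, LinearEquiv.symm_apply_apply]
      rfl
    have h1 : M *ᵥ (A *ᵥ v₀) = g.1 *ᵥ (A *ᵥ v₀) := by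
      rw [Matrix.mulVec_mulVec, Matrix.mulVec_mulVec, ← hMA, ← hg, ← Matrix.mulVec_mulVec,
        ← Matrix.mulVec_mulVec, h0]
    exact h.planeArea_ne_zero hv₀ (planeArea_eq_zero_of_eigenvectors hne
      (by rw [Matrix.sub_mulVec, h0, sub_self, zero_smul])
      (by rw [Matrix.sub_mulVec, h1, sub_self, zero_smul]))
  rw [zero_smul, sub_eq_zero] at hMg
  refine ⟨g, Units.mk0 b hb0, rfl, fun v => ?_⟩
  have h1 : g • v = M *ᵥ v := by
    rw [hMg]
    rfl
  rw [h1, hM, LinearEquiv.apply_symm_apply, Units.val_mk0]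

end Norm

/-- Traceless matrices satisfy `A k + k A = tr(k A)`, the polarised Cayley–Hamilton identity, so
orthogonality for the trace form is anticommutation. -/
lemma FormClass.exists_anti (h2 : (2 : F) ≠ 0) {x : FormClass F} (hx : ¬ x.IsScalar) :
    ∃ g : GL (Fin 2) F, Anti g x := by
  obtain ⟨k, hk, hkd, hkx⟩ := exists_traceless_orthogonal h2 (trace_mat hx)
  refine ⟨Matrix.GeneralLinearGroup.mkOfDetNeZero k hkd, ?_⟩
  change x.mat * k = -(k * x.mat)
  have hA := trace_mat hx
  rw [Matrix.trace_fin_two] at hk hA hkx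
  simp only [Matrix.mul_apply, Fin.sum_univ_two] at hkx
  ext i j
  fin_cases i <;> fin_cases j <;> simp [Matrix.mul_apply, Fin.sum_univ_two]
  · linear_combination hkx - k 1 1 * hA + x.mat 0 0 * hk
  · linear_combination k 0 1 * hA + x.mat 0 1 * hk
  · linear_combination k 1 0 * hA + x.mat 1 0 * hk
  · linear_combination hkx + k 1 1 * hA - x.mat 0 0 * hk

/-! ### Sign characters on the three orbits and the characters of the models -/

variable [Fintype F] [DecidableEq F]

lemma IsSplitClass.quadraticChar_eq {e : (Fin 2 → F) ≃ₗ[F] F × F} {x : FormClass F}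
    (h : IsSplitClass e x) : quadraticChar F (-x.mat.det) = 1 :=
  (quadraticChar_one_iff_isSquare (neg_ne_zero.2 x.det_mat_ne_zero)).2 h.exists_isSquare

lemma IsNormClass.quadraticChar_eq {E : Type v} [Field E] [Algebra F E]
    {e : (Fin 2 → F) ≃ₗ[F] E} {x : FormClass F}
    (h : IsNormClass e x) : quadraticChar F (-x.mat.det) = -1 :=
  quadraticChar_neg_one_iff_not_isSquare.2 h.not_isSquare

lemma IsSplitClass.orderOf_isotropySign (hF : ringChar F ≠ 2) {e : (Fin 2 → F) ≃ₗ[F] F × F}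
    {x : FormClass F} (h : IsSplitClass e x) : orderOf (isotropySign x) = 2 := by
  have h2 : (2 : F) ≠ 0 := Ring.two_ne_zero hF
  have hx := h.not_isScalar
  refine orderOf_eq_prime ?_ fun h1 => ?_
  · refine MonoidHom.ext fun ⟨γ, hγ⟩ => Units.ext ?_
    obtain ⟨g, rfl⟩ := Matrix.ProjGenLinGroup.mk_surjective γ
    rw [MonoidHom.pow_apply, Units.val_pow_eq_pow_val, FormClass.isotropySign_eq_weight hF,
      FormClass.weight, if_neg hx, h.quadraticChar_eq]
    split_ifs <;> simp
  · obtain ⟨g, hg⟩ := FormClass.exists_anti h2 hx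
    have hγ := (FormClass.smul_eq_self_iff hx g).2 (Or.inr hg)
    have h3 := FormClass.isotropySign_of_anti h2 hx g hγ hg
    rw [h1, h.quadraticChar_eq] at h3
    norm_num at h3

lemma IsNormClass.isotropySign_eq_one (hF : ringChar F ≠ 2) {E : Type v} [Field E] [Algebra F E]
    {e : (Fin 2 → F) ≃ₗ[F] E} {x : FormClass F} (h : IsNormClass e x) : isotropySign x = 1 := by
  refine MonoidHom.ext fun ⟨γ, hγ⟩ => Units.ext ?_
  obtain ⟨g, rfl⟩ := Matrix.ProjGenLinGroup.mk_surjective γ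
  rw [FormClass.isotropySign_eq_weight hF, FormClass.weight, if_neg h.not_isScalar,
    h.quadraticChar_eq]
  split_ifs <;> simp

/-- A character of order two of the isotropy group of the norm form class which is trivial on the
non-split torus is `-1` outside of the torus. -/
lemma IsNormClass.character_eq_weight (hF : ringChar F ≠ 2) {E : Type v} [Field E] [Algebra F E]
    {e : (Fin 2 → F) ≃ₗ[F] E} {x : FormClass F} (h : IsNormClass e x)
    (ψ : MulAction.stabilizer PGL(2, F) x →* ℂˣ) (hψ : orderOf ψ = 2)
    (hT : ∀ h : MulAction.stabilizer PGL(2, F) x, MemTorus e h → ψ h = 1) (g : GL (Fin 2) F)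
    (hg : (Matrix.ProjGenLinGroup.mk g : PGL(2, F)) ∈ MulAction.stabilizer PGL(2, F) x) :
    (ψ ⟨_, hg⟩ : ℂ) = FormClass.weight 1 g x := by
  have h2 : (2 : F) ≠ 0 := Ring.two_ne_zero hF
  have hx := h.not_isScalar
  have hcomm : ∀ (g : GL (Fin 2) F)
      (hg : (Matrix.ProjGenLinGroup.mk g : PGL(2, F)) ∈ MulAction.stabilizer PGL(2, F) x),
      FormClass.Comm g x → ψ ⟨_, hg⟩ = 1 :=
    fun g hg hc => hT ⟨_, hg⟩ (h.memTorus_of_comm h2 hc)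
  have hψ2 : ψ ^ 2 = 1 := orderOf_dvd_iff_pow_eq_one.1 hψ.dvd
  have hsq : ∀ γ, ψ γ * ψ γ = 1 := fun γ => by
    rw [← pow_two, ← MonoidHom.pow_apply, hψ2, MonoidHom.one_apply]
  rw [FormClass.weight, if_neg hx, h.quadraticChar_eq]
  split_ifs with hc
  · rw [hcomm g hg hc]
    simp
  · have ha := ((FormClass.smul_eq_self_iff hx g).1 hg).resolve_left hc
    obtain ⟨⟨γ₀, hγ₀⟩, hne⟩ : ∃ γ, ψ γ ≠ 1 := by
      by_contra! h1
      have : ψ = 1 := MonoidHom.ext h1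
      rw [this, orderOf_one] at hψ
      exact absurd hψ (by decide)
    obtain ⟨g₀, rfl⟩ := Matrix.ProjGenLinGroup.mk_surjective γ₀
    have ha₀ := ((FormClass.smul_eq_self_iff hx g₀).1 hγ₀).resolve_left
      fun hc => hne (hcomm g₀ hγ₀ hc)
    -- A product of two anticommuting elements commutes, hence lies in the torus, where `ψ` is
    -- trivial. So `ψ` takes at `g` the same value as at `g₀`, and this is not `1`.
    have hprod : FormClass.Comm (g * g₀) x := by
      rw [FormClass.Comm, Units.val_mul, ← mul_assoc, ha, neg_mul, mul_assoc, ha₀, mul_neg, neg_neg,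
        mul_assoc]
    have h3 : ψ ⟨_, hg⟩ * ψ ⟨_, hγ₀⟩ = 1 := by
      rw [← map_mul]
      exact hcomm (g * g₀) (mul_mem hg hγ₀) hprod
    have h4 : ψ ⟨_, hg⟩ = ψ ⟨_, hγ₀⟩ := by
      rw [eq_inv_of_mul_eq_one_left h3]
      exact (eq_inv_of_mul_eq_one_left (hsq _)).symm
    have h5 : (ψ ⟨_, hγ₀⟩ : ℂ) * ψ ⟨_, hγ₀⟩ = 1 := by
      rw [← Units.val_mul, hsq, Units.val_one]
    rw [h4]
    rcases mul_self_eq_one_iff.1 h5 with h6 | h6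
    · exact absurd (Units.ext h6) hne
    · rw [h6]
      simp

open scoped Classical in
/-- The character of a sum of representations induced from the isotropy groups of the three
classes of forms. -/
theorem character_prod_indChar {E : Type v} [Field E] [Algebra F E]
    {e₁ : (Fin 2 → F) ≃ₗ[F] F × F} {e₂ : (Fin 2 → F) ≃ₗ[F] E} {x₁ x₂ x₃ : FormClass F}
    (h₁ : IsSplitClass e₁ x₁) (h₂ : IsNormClass e₂ x₂) (h₃ : IsAlternatingClass x₃) (δ : ℤ)
    (ψ₁ : MulAction.stabilizer PGL(2, F) x₁ →* ℂˣ) (ψ₂ : MulAction.stabilizer PGL(2, F) x₂ →* ℂˣ)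
    (ψ₃ : MulAction.stabilizer PGL(2, F) x₃ →* ℂˣ)
    (hψ₁ : ∀ g hg, (ψ₁ ⟨Matrix.ProjGenLinGroup.mk g, hg⟩ : ℂ) = FormClass.weight δ g x₁)
    (hψ₂ : ∀ g hg, (ψ₂ ⟨Matrix.ProjGenLinGroup.mk g, hg⟩ : ℂ) = FormClass.weight δ g x₂)
    (hψ₃ : ∀ g hg, (ψ₃ ⟨Matrix.ProjGenLinGroup.mk g, hg⟩ : ℂ) = FormClass.weight δ g x₃)
    (g : GL (Fin 2) F) :
    (((indChar _ ψ₁).prod (indChar _ ψ₂)).prod (indChar _ ψ₃)).character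
        (Matrix.ProjGenLinGroup.mk g) =
      ∑ x : FormClass F with (Matrix.ProjGenLinGroup.mk g : PGL(2, F)) • x = x,
        (FormClass.weight δ g x : ℂ) := by
  have key : ∀ (x : FormClass F) (ψ : MulAction.stabilizer PGL(2, F) x →* ℂˣ),
      (∀ g hg, (ψ ⟨Matrix.ProjGenLinGroup.mk g, hg⟩ : ℂ) = FormClass.weight δ g x) →
      (indChar _ ψ).character (Matrix.ProjGenLinGroup.mk g) =
        ∑ y : FormClass F with y ∈ MulAction.orbit PGL(2, F) x ∧
          (Matrix.ProjGenLinGroup.mk g : PGL(2, F)) • y = y, (FormClass.weight δ g y : ℂ) := by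
    intro x ψ hψ
    refine character_indChar_stabilizer x ψ _ (fun y => (FormClass.weight δ g y : ℂ))
      fun k hk => ?_
    obtain ⟨k, rfl⟩ := Matrix.ProjGenLinGroup.mk_surjective k
    rw [FormClass.weight_smul]
    exact (hψ _ hk).symm
  rw [Representation.character_prod, Representation.character_prod, key _ _ hψ₁, key _ _ hψ₂,
    key _ _ hψ₃, Finset.sum_filter, Finset.sum_filter, Finset.sum_filter, Finset.sum_filter,
    ← Finset.sum_add_distrib, ← Finset.sum_add_distrib]
  refine Finset.sum_congr rfl fun y _ => ?_
  simp only [FormClass.mem_orbit_iff h₁.not_isScalar, FormClass.mem_orbit_iff h₂.not_isScalar,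
    h₃.isScalar.mem_orbit_iff, h₁.quadraticChar_eq, h₂.quadraticChar_eq]
  -- Each class lies in exactly one of the three orbits: the alternating one, or the one given by
  -- the sign of `χ(-det)`.
  by_cases hy : y.IsScalar
  · simp [hy]
  · rcases quadraticChar_dichotomy (neg_ne_zero.2 y.det_mat_ne_zero) with h | h <;> simp [hy, h]

/-- The sign characters of the isotropy groups extend to the action groupoid. -/
theorem exists_isSignExtension (hF : ringChar F ≠ 2) :
    ∃ σ : ActionCategory PGL(2, F) (FormClass F) ⥤ FGModuleCat.{w} ℂ, IsSignExtension σ := by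
  refine exists_groupoidRep (G := PGL(2, F)) (X := FormClass F) isotropySign fun k x h h' => ?_
  obtain ⟨γ, hγ⟩ := h
  obtain ⟨g, rfl⟩ := Matrix.ProjGenLinGroup.mk_surjective γ
  obtain ⟨k, rfl⟩ := Matrix.ProjGenLinGroup.mk_surjective k
  refine Units.ext ?_
  rw [FormClass.isotropySign_eq_weight hF, FormClass.weight_smul]
  exact (FormClass.isotropySign_eq_weight hF x _ h').symm

open scoped Classical in
theorem IsSignExtension.character_groupoidInd (hF : ringChar F ≠ 2)
    {σ : ActionCategory PGL(2, F) (FormClass F) ⥤ FGModuleCat.{w} ℂ} (hσ : IsSignExtension σ)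
    (g : GL (Fin 2) F) :
    (groupoidInd σ).character (Matrix.ProjGenLinGroup.mk g) =
      ∑ x : FormClass F with (Matrix.ProjGenLinGroup.mk g : PGL(2, F)) • x = x,
        (FormClass.weight (-1) g x : ℂ) :=
  _root_.character_groupoidInd σ hσ.1 _ _ fun x h => by
    rw [← FormClass.isotropySign_eq_weight hF x g h]
    exact hσ.2 x ⟨_, h⟩

end Classes

theorem mainTheorem2 {F : Type u} [Field F] [Fintype F] [DecidableEq F] (hF : ringChar F ≠ 2)
    {E : Type v} [Field E] [Algebra F E]
    (e₁ : (Fin 2 → F) ≃ₗ[F] F × F) (e₂ : (Fin 2 → F) ≃ₗ[F] E)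
    (x₁ x₂ x₃ : FormClass F)
    (h₁ : IsSplitClass e₁ x₁) (h₂ : IsNormClass e₂ x₂) (h₃ : IsAlternatingClass x₃) :
    -- the restrictions of `ε` to the three isotropy groups
    (orderOf (isotropySign x₁) = 2 ∧
      (∀ h : MulAction.stabilizer PGL(2, F) x₁, MemTorus e₁ h → isotropySign x₁ h = 1) ∧
      isotropySign x₂ = 1 ∧
      isotropySign x₃ = detSign.comp (MulAction.stabilizer PGL(2, F) x₃).subtype) ∧
    -- `ε` extends to the action groupoid
    (∃ σ : ActionCategory PGL(2, F) (FormClass F) ⥤ FGModuleCat.{w} ℂ, IsSignExtension σ) ∧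
    ∀ σ : ActionCategory PGL(2, F) (FormClass F) ⥤ FGModuleCat.{w} ℂ, IsSignExtension σ →
      -- the induced representation is the sum of the three induced representations
      Nonempty ((groupoidInd σ).Equiv
        (((indChar (MulAction.stabilizer PGL(2, F) x₁) (isotropySign x₁)).prod
          (indChar (MulAction.stabilizer PGL(2, F) x₂) (isotropySign x₂))).prod
          (indChar (MulAction.stabilizer PGL(2, F) x₃) (isotropySign x₃)))) ∧
      -- it is a Gelfand model
      IsGelfandModel (groupoidInd σ) ∧
      -- it is the model `Ind 1 ⊕ Ind ψ₂ ⊕ Ind sgn`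
      ∀ ψ₂ : MulAction.stabilizer PGL(2, F) x₂ →* ℂˣ, orderOf ψ₂ = 2 →
        (∀ h : MulAction.stabilizer PGL(2, F) x₂, MemTorus e₂ h → ψ₂ h = 1) →
        Nonempty ((groupoidInd σ).Equiv
          (((indChar (MulAction.stabilizer PGL(2, F) x₁) 1).prod
            (indChar (MulAction.stabilizer PGL(2, F) x₂) ψ₂)).prod
            (indChar (MulAction.stabilizer PGL(2, F) x₃)
              (detSign.comp (MulAction.stabilizer PGL(2, F) x₃).subtype)))) := by
  classical
  refine ⟨⟨h₁.orderOf_isotropySign hF, fun h => h₁.isotropySign_eq_one_of_memTorus h,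
    h₂.isotropySign_eq_one hF, h₃.isScalar.isotropySign_eq hF⟩, exists_isSignExtension hF,
    fun σ hσ => ⟨?_, ?_, fun ψ₂ hψ hT => ?_⟩⟩
  · refine Representation.nonempty_equiv_of_character_eq (funext fun γ => ?_)
    obtain ⟨g, rfl⟩ := Matrix.ProjGenLinGroup.mk_surjective γ
    rw [hσ.character_groupoidInd hF, character_prod_indChar h₁ h₂ h₃ (-1)]
    all_goals exact FormClass.isotropySign_eq_weight hF _
  · refine IsGelfandModel.of_character_eq_card_sqrt _
      (Matrix.ProjGenLinGroup.isConj_inv (Ring.two_ne_zero hF)) fun γ => ?_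
    obtain ⟨g, rfl⟩ := Matrix.ProjGenLinGroup.mk_surjective γ
    rw [hσ.character_groupoidInd hF]
    exact_mod_cast FormClass.sum_weight_eq_card_sqrt hF (-1) g
  · refine Representation.nonempty_equiv_of_character_eq (funext fun γ => ?_)
    obtain ⟨g, rfl⟩ := Matrix.ProjGenLinGroup.mk_surjective γ
    rw [hσ.character_groupoidInd hF, character_prod_indChar h₁ h₂ h₃ 1]
    -- The weights for `δ = -1` and `δ = 1` have the same sum, the number of square roots.
    · exact_mod_cast (FormClass.sum_weight_eq_card_sqrt hF (-1) g).trans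
        (FormClass.sum_weight_eq_card_sqrt hF 1 g).symm
    -- For `δ = 1` the weight on the split class is `1`, even for anticommuting elements, because
    -- `χ(-det) = 1` there.
    · intro g hg
      rw [FormClass.weight, if_neg h₁.not_isScalar, h₁.quadraticChar_eq]
      split_ifs <;> simp
    · exact h₂.character_eq_weight hF ψ₂ hψ hT
    · intro g hg
      rw [FormClass.weight, if_pos h₃.isScalar]
      rfl
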